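/- **Setting.** Let $\mathbb F$ be a field. A closed Pfaffian circuit has as its underlying graph a connected bipartite graph $\Gamma$ with $n\ge 1$ edges (parallel edges are allowed), given with a planar embedding, i.e. with a cyclic counterclockwise order of the edges at each vertex that satisfies Euler's formula. The two kinds of vertices are called gates and cogates. Each edge $e$ carries the space $V^e=\mathbb F^2$ with its standard basis and a change of basis $A_e\in GL_2(\mathbb F)$. Each gate $G$ is a tensor in the product of the $V^e$ over its incident edges. Each cogate $J$ is a tensor in the product of the duals $V^{e\vee}$ over its incident edges. The value $\operatorname{val}(\Gamma)\in\mathbb F$ is the total contraction. *Spanning tree order.* Join, around each face (including the exterior one), the gate corners of that face in a cycle by curves inside the face. This gives a planar multigraph on the gates. Take a spanning tree of it and thicken the tree and the gates. The oriented boundary of the thickening is a closed curve that crosses each edge of $\Gamma$ exactly once. Numbering the edges $1,\dots,n$ in the order in which they are crossed, from any start, gives a spanning tree order. *Pfaffian gates and cogates.* Fix a spanning tree order and label all tensors and matrices by it. For a skew-symmetric matrix $A$ with label set $L$ (with zero diagonal, also in characteristic $2$) put $\operatorname{sPf}(A)=\sum_{I\subseteq L}\operatorname{Pf}(A_I)\,|I\rangle$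 and $\operatorname{sPf}^\vee(A)=\sum_{I\subseteq L}\operatorname{Pf}(A_{L\setminus I})\,\langle I|$, where $|I\rangle$ is the standard basis tensor with ones exactly at $I$. The circuit is Pfaffian: after applying $A_e$ at the edges of the gates and $(A_e^{-1})^{\top}$ at the edges of the cogates, each gate equals $\alpha_G\operatorname{sPf}(\Xi_G)$ and each cogate equals $\beta_J\operatorname{sPf}^\vee(\Theta_J)$, with scalars $\alpha_G,\beta_J$ and skew-symmetric matrices $\Xi_G,\Theta_J$ labelled by the incident edges. Put $\gamma=\prod_G\alpha_G\prod_J\beta_J$, $\tilde\theta_{ij}=(-1)^{i+j+1}\theta_{ij}$ and $\Omega=\bigoplus_G\Xi_G+\bigoplus_J\tilde\Theta_J$. *Complexity.* Programs run on a random access machine over $\mathbb F$, with arrays of natural numbers and of field elements. Every memory access, every arithmetic operation on natural numbers or on $\mathbb F$, and every test costs one step. "Evaluating planar Pfaffians with graph $\Gamma$" means: given the embedded graph, a spanning tree order, and a skew-symmetric $n\times n$ matrix over $\mathbb F$ with rows and columns labelled by the ordered edges, whose nonzero entries belong to pairs of edges with a common vertex, output its Pfaffian. "Computing circuit values with graph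 $\Gamma$" means: given the embedded graph, a spanning tree order, and the data $\alpha_G,\Xi_G,\beta_J,\Theta_J$ of a closed Pfaffian circuit, output $\operatorname{val}(\Gamma)$. **Theorem.** 1. Every embedded graph $\Gamma$ as above has a spanning tree order, and one is computed from the embedding by a program in $O(n)$ steps. 2. For every closed Pfaffian circuit and every spanning tree order, $\operatorname{val}(\Gamma)=\gamma\cdot\operatorname{Pf}(\Omega)$. 3. There is a constant $c$ such that, for every class $\mathcal K$ of embedded graphs and every time bound $T$: if some program evaluates all planar Pfaffians with graph $\Gamma\in\mathcal K$ in at most $T(\Gamma)$ steps, then some program computes the values of all closed Pfaffian circuits with graph $\Gamma\in\mathcal K$ in at most $c\,(T(\Gamma)+n)$ steps. 4. In particular, for every real $\omega_p\ge 1$: if planar Pfaffians with graph in $\mathcal K$ are evaluated by a program in $O(n^{\omega_p})$ steps, then the values of closed Pfaffian circuits with graph in $\mathcal K$ are computed by a program in $O(n^{\omega_p})$ steps. -/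

import Mathlib

open Finset

namespace PfCircuit

section Pfaffians

variable {R : Type*} [CommRing R]

/-- The permutations indexing the terms of a Pfaffian, with 0-based positions:
`σ 0 < σ 1`, `σ 2 < σ 3`, ... and `σ 0 < σ 2 < σ 4 < ...`. -/
def IsPairing {m : ℕ} (σ : Equiv.Perm (Fin m)) : Prop :=
  (∀ k : Fin (m / 2), σ ⟨2 * k, by omega⟩ < σ ⟨2 * k + 1, by omega⟩) ∧
  ∀ k l : Fin (m / 2), k < l → σ ⟨2 * k, by omega⟩ < σ ⟨2 * l, by omega⟩

open Classical in
/-- The Pfaffian: `0` for odd `m`, and `1` for `m = 0`. -/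
noncomputable def pf {m : ℕ} (A : Matrix (Fin m) (Fin m) R) : R :=
  if Even m then
    ∑ σ : Equiv.Perm (Fin m) with IsPairing σ,
      ((Equiv.Perm.sign σ : ℤ) : R) *
        ∏ k : Fin (m / 2), A (σ ⟨2 * k, by omega⟩) (σ ⟨2 * k + 1, by omega⟩)
  else 0

/-- The Pfaffian of the submatrix `A_I`, rows and columns in increasing order of their labels. -/
noncomputable def subPf {ι : Type*} [LinearOrder ι] (A : Matrix ι ι R) (I : Finset ι) : R :=
  pf (A.submatrix (I.orderEmbOfFin rfl) (I.orderEmbOfFin rfl))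

/-- Coefficients of `sPf A = ∑_I Pf(A_I) |I⟩`: the bitstring `y` stands for its set of ones. -/
noncomputable def sPf {ι : Type*} [LinearOrder ι] [Fintype ι] (A : Matrix ι ι R)
    (y : ι → Fin 2) : R :=
  subPf A (univ.filter fun i => y i = 1)

/-- Coefficients of `sPf^∨ A = ∑_J Pf(A_{J^c}) ⟨J|`. -/
noncomputable def sPfDual {ι : Type*} [LinearOrder ι] [Fintype ι] (A : Matrix ι ι R)
    (y : ι → Fin 2) : R :=
  subPf A (univ.filter fun i => y i = 1)ᶜ

/-- Skew-symmetric matrices, with zero diagonal also in characteristic two. -/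
def IsSkew {ι : Type*} (A : Matrix ι ι R) : Prop :=
  (∀ i, A i i = 0) ∧ ∀ i j, A j i = -A i j

/-- The checkerboard sign flip `A i j ↦ (-1)^(i+j+1) A i j`, which flips the diagonal. -/
def checkerboard {n : ℕ} (A : Matrix (Fin n) (Fin n) R) : Matrix (Fin n) (Fin n) R :=
  fun i j => (-1) ^ ((i : ℕ) + (j : ℕ) + 1) * A i j

end Pfaffians

/-- A connected bipartite graph (parallel edges allowed) with a planar embedding, given as a
combinatorial map: `p` gates, `q` cogates, `n` edges, and at every vertex the counterclockwise
cyclic order of its edges. The faces are the cycles of `rotG⁻¹ * rotC⁻¹`, and planarity of the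
embedding is Euler's formula. There is at least one edge: for `n = 0` there would be a single
vertex, and no cycles at all. -/
structure PlanarGraph where
  n : ℕ
  p : ℕ
  q : ℕ
  gate : Fin n → Fin p
  cogate : Fin n → Fin q
  /-- next edge counterclockwise around the gate of an edge -/
  rotG : Equiv.Perm (Fin n)
  /-- next edge counterclockwise around the cogate of an edge -/
  rotC : Equiv.Perm (Fin n)
  gate_eq_iff : ∀ e f, gate e = gate f ↔ rotG.SameCycle e f
  cogate_eq_iff : ∀ e f, cogate e = cogate f ↔ rotC.SameCycle e f
  connected : (SimpleGraph.fromRel fun u v : Fin p ⊕ Fin q =>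
    ∃ e, u = Sum.inl (gate e) ∧ v = Sum.inr (cogate e)).Connected
  euler : p + q + Nat.card (Quotient (Equiv.Perm.SameCycle.setoid (rotG⁻¹ * rotC⁻¹))) = n + 2

namespace PlanarGraph

variable (M : PlanarGraph)

/-- The edge `e` also names the corner at its gate between `e` and the next edge `rotG e`. Walking
around the face of that corner (face on the left: along `e` to its cogate, then back along
`rotC⁻¹ e`), the next gate corner that is met is `next e`. -/
def next : Equiv.Perm (Fin M.n) := M.rotG⁻¹ * M.rotC⁻¹

/-- The region graph: its vertices are the gates, and around every face the gate corners of that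
face are joined in a cycle. Its edges are again named by `e : Fin n`: the edge `e` runs inside a
face from the corner `e` to the corner `next e`. A set `T` of these edges is a spanning tree if it
connects all gates and has one element less than there are gates. -/
def IsSpanningTree (T : Finset (Fin M.n)) : Prop :=
  (SimpleGraph.fromRel fun g h : Fin M.p =>
    ∃ e ∈ T, g = M.gate e ∧ h = M.gate (M.next e)).Connected ∧ T.card + 1 = M.p

/-- The oriented boundary of a thickening of the gates and of the tree `T` (thickened part on the
left) crosses the graph edge `e'` directly after the graph edge `e`.

After crossing `e` the curve is in the corner `e`. The first region edge there is the one to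
`next e`; if it is in `T`, the curve follows it and then crosses `rotC⁻¹ e`. Otherwise, as long as
the other region edge of the current corner, the one from the preceding corner of the face, is in
`T`, the curve follows that one backwards; when it is not, the curve crosses the second graph
edge of the current corner. -/
def Follows (T : Finset (Fin M.n)) (e e' : Fin M.n) : Prop :=
  (e ∈ T ∧ e' = M.rotC⁻¹ e) ∨
  (e ∉ T ∧ ∃ k : ℕ, (∀ j < k, ((M.next⁻¹) ^ (j + 1)) e ∈ T) ∧ ((M.next⁻¹) ^ (k + 1)) e ∉ T ∧
    e' = M.rotG (((M.next⁻¹) ^ k) e))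

/-- `o` lists the edges (label `i` is given to the edge `o i`) in the order in which they are
crossed by the closed curve around a spanning tree of the region graph, from any start. -/
def IsSpanningTreeOrder (o : Equiv.Perm (Fin M.n)) : Prop :=
  ∃ T, M.IsSpanningTree T ∧ ∀ i, M.Follows T (o i) (o (finRotate M.n i))

/-- The labels of the edges at a gate. -/
abbrev GateLabels (o : Equiv.Perm (Fin M.n)) (g : Fin M.p) : Type :=
  {i : Fin M.n // M.gate (o i) = g}

/-- The labels of the edges at a cogate. -/
abbrev CogateLabels (o : Equiv.Perm (Fin M.n)) (c : Fin M.q) : Type :=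
  {i : Fin M.n // M.cogate (o i) = c}

end PlanarGraph

/-- A closed tensor contraction circuit on an embedded graph, in coordinates with respect to the
standard bases. The gate and the cogate incident on an edge agree on its type, that is, on the
change of basis on the vector space of that edge. -/
structure Circuit (F : Type*) [Field F] (M : PlanarGraph) where
  gateTensor : ∀ g : Fin M.p, ({e // M.gate e = g} → Fin 2) → F
  cogateTensor : ∀ c : Fin M.q, ({e // M.cogate e = c} → Fin 2) → F
  basis : Fin M.n → GL (Fin 2) F

namespace Circuit

variable {F : Type*} [Field F] {M : PlanarGraph} (C : Circuit F M)

/-- The total contraction. -/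
def value : F :=
  ∑ x : Fin M.n → Fin 2,
    (∏ g, C.gateTensor g fun e => x e) * ∏ c, C.cogateTensor c fun e => x e

/-- A gate after the change of basis `A` on each of its edges. -/
def gateAfter (g : Fin M.p) (y : {e // M.gate e = g} → Fin 2) : F :=
  ∑ x : {e // M.gate e = g} → Fin 2, (∏ e : {e // M.gate e = g}, (C.basis e).val (y e) (x e)) * C.gateTensor g x

/-- A cogate after the dual change of basis `(A⁻¹)ᵀ` on each of its edges. -/
def cogateAfter (c : Fin M.q) (y : {e // M.cogate e = c} → Fin 2) : F :=
  ∑ x : {e // M.cogate e = c} → Fin 2,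
    (∏ e : {e // M.cogate e = c}, ((C.basis e)⁻¹).val.transpose (y e) (x e)) * C.cogateTensor c x

end Circuit

/-- Scaling constants and skew-symmetric matrices for the gates and cogates, the rows and columns
of each matrix being labelled by the labels of the incident edges. -/
structure PfaffianData (F : Type*) [Field F] (M : PlanarGraph) (o : Equiv.Perm (Fin M.n)) where
  α : Fin M.p → F
  Ξ : ∀ g, Matrix (M.GateLabels o g) (M.GateLabels o g) F
  β : Fin M.q → F
  Θ : ∀ c, Matrix (M.CogateLabels o c) (M.CogateLabels o c) F
  skewΞ : ∀ g, IsSkew (Ξ g)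
  skewΘ : ∀ c, IsSkew (Θ c)

namespace PfaffianData

variable {F : Type*} [Field F] {M : PlanarGraph} {o : Equiv.Perm (Fin M.n)}
  (D : PfaffianData F M o)

/-- After the changes of basis, every gate of `C` is `α sPf Ξ` and every cogate is `β sPf^∨ Θ`,
as edge-labelled tensors. -/
def Represents (C : Circuit F M) : Prop :=
  (∀ g y, C.gateAfter g y = D.α g * sPf (D.Ξ g) fun i => y ⟨o i.1, i.2⟩) ∧
  (∀ c y, C.cogateAfter c y = D.β c * sPfDual (D.Θ c) fun i => y ⟨o i.1, i.2⟩)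

/-- The direct sum of the labelled matrices `Ξ`. -/
def sumΞ : Matrix (Fin M.n) (Fin M.n) F := fun i j =>
  if h : M.gate (o i) = M.gate (o j) then D.Ξ (M.gate (o j)) ⟨i, h⟩ ⟨j, rfl⟩ else 0

/-- The direct sum of the labelled matrices `Θ`. -/
def sumΘ : Matrix (Fin M.n) (Fin M.n) F := fun i j =>
  if h : M.cogate (o i) = M.cogate (o j) then D.Θ (M.cogate (o j)) ⟨i, h⟩ ⟨j, rfl⟩ else 0

/-- The matrix with blocks `Ξ` and sign-flipped blocks `Θ`. If no two edges are parallel, every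
off-diagonal entry is covered by at most one block. -/
def Ω : Matrix (Fin M.n) (Fin M.n) F := D.sumΞ + checkerboard D.sumΘ

def γ : F := (∏ g, D.α g) * ∏ c, D.β c

end PfaffianData

/-! ### A random access machine over `F` with step count -/

section Machine

/-- Arrays of natural numbers, with one index, and of field elements, with two indices.
The first argument is the name of the array. -/
structure Store (F : Type*) where
  int : ℕ → ℕ → ℕ
  fld : ℕ → ℕ → ℕ → F

/-- The initial contents of the working memory. -/
def Store.zero (F : Type*) [Field F] : Store F := ⟨fun _ _ => 0, fun _ _ _ => 0⟩

/-- Integer expressions; `inp` reads an input array and `get` an array in working memory;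
subtraction is truncated. -/
inductive IExp where
  | const (k : ℕ)
  | inp (a : ℕ) (i : IExp)
  | get (a : ℕ) (i : IExp)
  | add (x y : IExp)
  | sub (x y : IExp)

/-- Field expressions, with `0⁻¹ = 0`. -/
inductive FExp (F : Type*) where
  | const (c : F)
  | inp (a : ℕ) (i j : IExp)
  | get (a : ℕ) (i j : IExp)
  | add (x y : FExp F)
  | sub (x y : FExp F)
  | mul (x y : FExp F)
  | inv (x : FExp F)

/-- Tests: comparison of integers, and equality of field elements. -/
inductive Test (F : Type*) where
  | lt (x y : IExp)
  | eq (x y : IExp)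
  | feq (x y : FExp F)

inductive Prog (F : Type*) where
  | skip
  | setI (a : ℕ) (i : IExp) (v : IExp)
  | setF (a : ℕ) (i j : IExp) (v : FExp F)
  | seq (P Q : Prog F)
  | ite (b : Test F) (P Q : Prog F)
  | while (b : Test F) (P : Prog F)

variable {F : Type*} [Field F]

def IExp.eval (inp s : Store F) : IExp → ℕ
  | const k => k
  | .inp a i => inp.int a (i.eval inp s)
  | get a i => s.int a (i.eval inp s)
  | add x y => x.eval inp s + y.eval inp s
  | sub x y => x.eval inp s - y.eval inp s

def FExp.eval (inp s : Store F) : FExp F → F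
  | const c => c
  | .inp a i j => inp.fld a (i.eval inp s) (j.eval inp s)
  | get a i j => s.fld a (i.eval inp s) (j.eval inp s)
  | add x y => x.eval inp s + y.eval inp s
  | sub x y => x.eval inp s - y.eval inp s
  | mul x y => x.eval inp s * y.eval inp s
  | inv x => (x.eval inp s)⁻¹

def Test.Holds (inp s : Store F) : Test F → Prop
  | lt x y => x.eval inp s < y.eval inp s
  | eq x y => x.eval inp s = y.eval inp s
  | feq x y => x.eval inp s = y.eval inp s

/-- Every constant, memory access and arithmetic operation costs one step. -/
def IExp.cost : IExp → ℕ
  | const _ => 1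
  | inp _ i => i.cost + 1
  | get _ i => i.cost + 1
  | add x y => x.cost + y.cost + 1
  | sub x y => x.cost + y.cost + 1

def FExp.cost : FExp F → ℕ
  | const _ => 1
  | inp _ i j => i.cost + j.cost + 1
  | get _ i j => i.cost + j.cost + 1
  | add x y => x.cost + y.cost + 1
  | sub x y => x.cost + y.cost + 1
  | mul x y => x.cost + y.cost + 1
  | inv x => x.cost + 1

def Test.cost : Test F → ℕ
  | lt x y => x.cost + y.cost + 1
  | eq x y => x.cost + y.cost + 1
  | feq x y => x.cost + y.cost + 1

def Store.setI (s : Store F) (a i v : ℕ) : Store F :=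
  ⟨Function.update s.int a (Function.update (s.int a) i v), s.fld⟩

def Store.setF (s : Store F) (a i j : ℕ) (v : F) : Store F :=
  ⟨s.int, Function.update s.fld a (Function.update (s.fld a) i (Function.update (s.fld a i) j v))⟩

/-- `Exec inp P s s' t`: on the input `inp`, the program `P` started with working memory `s`
halts with working memory `s'` after `t` steps. -/
inductive Exec (inp : Store F) : Prog F → Store F → Store F → ℕ → Prop
  | skip (s) : Exec inp .skip s s 1
  | setI (s a i v) : Exec inp (.setI a i v) s
      (s.setI a (i.eval inp s) (v.eval inp s)) (i.cost + v.cost + 1)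
  | setF (s a i j v) : Exec inp (.setF a i j v) s
      (s.setF a (i.eval inp s) (j.eval inp s) (v.eval inp s)) (i.cost + j.cost + v.cost + 1)
  | seq {P Q s₁ s₂ s₃ t u} : Exec inp P s₁ s₂ t → Exec inp Q s₂ s₃ u →
      Exec inp (.seq P Q) s₁ s₃ (t + u)
  | iteTrue {b P Q s s' t} : b.Holds inp s → Exec inp P s s' t →
      Exec inp (.ite b P Q) s s' (b.cost + t)
  | iteFalse {b P Q s s' t} : ¬b.Holds inp s → Exec inp Q s s' t →
      Exec inp (.ite b P Q) s s' (b.cost + t)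
  | whileTrue {b P s₁ s₂ s₃ t u} : b.Holds inp s₁ → Exec inp P s₁ s₂ t →
      Exec inp (.while b P) s₂ s₃ u → Exec inp (.while b P) s₁ s₃ (b.cost + t + u)
  | whileFalse {b P s} : ¬b.Holds inp s → Exec inp (.while b P) s s b.cost

end Machine

/-! ### Encodings of the inputs, and the two evaluation problems -/

/-- An array with the given entries, and zeros beyond. -/
def arr {F : Type*} [Zero F] {n : ℕ} (f : Fin n → F) (i : ℕ) : F :=
  if h : i < n then f ⟨i, h⟩ else 0

/-- A two-dimensional array with the given entries, and zeros beyond. -/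
def arr₂ {F : Type*} [Zero F] {m n : ℕ} (f : Fin m → Fin n → F) (i j : ℕ) : F :=
  arr (fun k => arr (f k) j) i

/-- The graph: its sizes, its rotations in both directions, and the end points of the edges. -/
def PlanarGraph.graphArrays (M : PlanarGraph) : ℕ → ℕ → ℕ
  | 0 => arr ![M.n, M.p, M.q]
  | 1 => arr fun e => (M.rotG e : ℕ)
  | 2 => arr fun e => (M.rotG⁻¹ e : ℕ)
  | 3 => arr fun e => (M.rotC e : ℕ)
  | 4 => arr fun e => (M.rotC⁻¹ e : ℕ)
  | 5 => arr fun e => (M.gate e : ℕ)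
  | 6 => arr fun e => (M.cogate e : ℕ)
  | _ => 0

/-- The graph together with an edge order: edge of a label, and label of an edge. -/
def PlanarGraph.orderedArrays (M : PlanarGraph) (o : Equiv.Perm (Fin M.n)) : ℕ → ℕ → ℕ
  | 7 => arr fun i => (o i : ℕ)
  | 8 => arr fun e => (o⁻¹ e : ℕ)
  | a => M.graphArrays a

def graphInput (F : Type*) [Field F] (M : PlanarGraph) : Store F :=
  ⟨M.graphArrays, fun _ _ _ => 0⟩

def pfaffianInput {F : Type*} [Field F] (M : PlanarGraph) (o : Equiv.Perm (Fin M.n))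
    (A : Matrix (Fin M.n) (Fin M.n) F) : Store F where
  int := M.orderedArrays o
  fld
    | 0 => arr₂ A
    | _ => 0

/-- The blocks `Ξ` and `Θ` are stored at the places given by their labels. -/
def circuitInput {F : Type*} [Field F] {M : PlanarGraph} {o : Equiv.Perm (Fin M.n)}
    (D : PfaffianData F M o) : Store F where
  int := M.orderedArrays o
  fld
    | 0 => arr₂ D.sumΞ
    | 1 => arr₂ D.sumΘ
    | 2 => fun g _ => arr D.α g
    | 3 => fun c _ => arr D.β c
    | _ => 0

/-- A matrix whose rows and columns are the labelled edges of `M`, and whose nonzero entries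
belong to pairs of edges that share a gate or a cogate. -/
def SupportedOn {F : Type*} [Field F] (M : PlanarGraph) (o : Equiv.Perm (Fin M.n))
    (A : Matrix (Fin M.n) (Fin M.n) F) : Prop :=
  ∀ i j, A i j ≠ 0 → M.gate (o i) = M.gate (o j) ∨ M.cogate (o i) = M.cogate (o j)

/-- One program computes a spanning tree order of every embedded graph, in time `T`. -/
def OrderInTime (F : Type*) [Field F] (T : PlanarGraph → ℝ) : Prop :=
  ∃ P : Prog F, ∀ M : PlanarGraph, ∃ o, M.IsSpanningTreeOrder o ∧
    ∃ s t, Exec (graphInput F M) P (Store.zero F) s t ∧ (t : ℝ) ≤ T M ∧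
      ∀ i : Fin M.n, s.int 0 i = o i

/-- One program evaluates, in time `T`, all planar Pfaffians over `F` with graph in `K`:
Pfaffians of skew-symmetric matrices supported on the graph, in spanning tree order. -/
def PlanarPfaffianInTime (F : Type*) [Field F] (K : Set PlanarGraph) (T : PlanarGraph → ℝ) :
    Prop :=
  ∃ P : Prog F, ∀ M ∈ K, ∀ o, M.IsSpanningTreeOrder o →
    ∀ A : Matrix (Fin M.n) (Fin M.n) F, IsSkew A → SupportedOn M o A →
      ∃ s t, Exec (pfaffianInput M o A) P (Store.zero F) s t ∧ (t : ℝ) ≤ T M ∧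
        s.fld 0 0 0 = pf A

/-- One program computes, in time `T`, the values of all closed Pfaffian circuits over `F` with
graph in `K`, given by the matrices and constants of their gates and cogates. -/
def CircuitValueInTime (F : Type*) [Field F] (K : Set PlanarGraph) (T : PlanarGraph → ℝ) :
    Prop :=
  ∃ P : Prog F, ∀ M ∈ K, ∀ o, M.IsSpanningTreeOrder o →
    ∀ (C : Circuit F M) (D : PfaffianData F M o), D.Represents C →
      ∃ s t, Exec (circuitInput D) P (Store.zero F) s t ∧ (t : ℝ) ≤ T M ∧
        s.fld 0 0 0 = C.value

end PfCircuit

open PfCircuit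

/-! The changes of basis cancel edge by edge in the contraction, so the value is γ times the sum,
over all label sets I, of the product of the Pfaffians of the gate blocks on I and of the cogate
blocks off I. When the blocks do not cross in the edge order, a product of Pfaffians of blocks is
the Pfaffian of their direct sum (`subPf_direct_sum`). The expansion of the Pfaffian of a sum
(`subPf_add`) then identifies the sum over I with Pf Ω, because the checkerboard signs cancel the
shuffle signs (`pf_add_checkerboard`).

Noncrossing comes from two trees. Deleting one edge of the spanning tree T splits the gates into two
sides, and the boundary curve of T changes sides only twice, once along each bank of that edge. By
Euler's formula the elements e outside T, read as edges joining the cogate of e to the face of e,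
also form a tree, and the same argument serves the cogates. Four alternating labels would need three
changes of side. Cuts are encoded as rational functions on the vertices, so that the rank of a
coboundary map replaces reasoning about paths.

The search for an order keeps a permutation φ of the edges: one cycle is the boundary curve of the
current tree, the others are the rotations at the unvisited gates. Walking along the curve, it
multiplies φ by a transposition whenever a region edge leads to a new gate; this splices the
rotation of that gate into the curve (`PartialTree.extend`) and leaves the part already walked
unchanged (`SearchState.step`).

In the reduction Ω is never written down, since that could take quadratic time. Each read of an
entry by the Pfaffian program is replaced by an expression in Ξ, Θ and stored signs, at the price of
a constant factor (`Exec.withBlocks`). -/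

namespace PfCircuit

/-! ### Expansion of the Pfaffian along its first row. -/

section PfaffianRecursion

variable {R : Type*} [CommRing R]

/-- The permutation of `Fin (m + 2)` that fixes `0`, sends `1` to `i + 1`, and acts on the
other positions as `τ` does. -/
def extendPerm {m : ℕ} (i : Fin (m + 1)) (τ : Equiv.Perm (Fin m)) : Equiv.Perm (Fin (m + 2)) :=
  Equiv.Perm.decomposeFin.symm (0, i.cycleRange.symm * Equiv.Perm.decomposeFin.symm (0, τ))

variable {m : ℕ}

lemma extendPerm_zero (i : Fin (m + 1)) (τ : Equiv.Perm (Fin m)) : extendPerm i τ 0 = 0 := by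
  simp [extendPerm]

lemma extendPerm_succ (i : Fin (m + 1)) (τ : Equiv.Perm (Fin m)) (x : Fin (m + 1)) :
    extendPerm i τ x.succ = (i.cycleRange.symm (Equiv.Perm.decomposeFin.symm (0, τ) x)).succ := by
  simp [extendPerm]

lemma extendPerm_one (i : Fin (m + 1)) (τ : Equiv.Perm (Fin m)) :
    extendPerm i τ (Fin.succ 0) = i.succ := by
  rw [extendPerm_succ]; simp

lemma extendPerm_succ_succ (i : Fin (m + 1)) (τ : Equiv.Perm (Fin m)) (x : Fin m) :
    extendPerm i τ x.succ.succ = (i.succAbove (τ x)).succ := by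
  rw [extendPerm_succ]; simp

lemma sign_extendPerm (i : Fin (m + 1)) (τ : Equiv.Perm (Fin m)) :
    Equiv.Perm.sign (extendPerm i τ) = (-1) ^ (i : ℕ) * Equiv.Perm.sign τ := by
  simp [extendPerm, Equiv.Perm.decomposeFin.symm_sign]

lemma exists_decomposeFin_symm {n : ℕ} (σ : Equiv.Perm (Fin (n + 1))) (h : σ 0 = 0) :
    ∃ τ, σ = Equiv.Perm.decomposeFin.symm (0, τ) := by
  obtain ⟨⟨p, τ⟩, rfl⟩ := Equiv.Perm.decomposeFin.symm.surjective σ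
  simp only [Equiv.Perm.decomposeFin_symm_apply_zero] at h
  exact ⟨τ, by rw [h]⟩

lemma exists_extendPerm (σ : Equiv.Perm (Fin (m + 2))) (h : σ 0 = 0) :
    ∃ i τ, σ = extendPerm i τ := by
  obtain ⟨ρ, rfl⟩ := exists_decomposeFin_symm σ h
  obtain ⟨τ, hτ⟩ := exists_decomposeFin_symm ((ρ 0).cycleRange * ρ) (by simp)
  refine ⟨ρ 0, τ, ?_⟩
  unfold extendPerm
  rw [← hτ]
  congr 2
  ext x
  simp

lemma extendPerm_injective :
    Function.Injective fun x : Fin (m + 1) × Equiv.Perm (Fin m) => extendPerm x.1 x.2 := by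
  rintro ⟨i, τ⟩ ⟨j, ρ⟩ h
  have hi : i = j := by
    have := congrArg (fun σ : Equiv.Perm (Fin (m + 2)) => σ (Fin.succ 0)) h
    simpa only [extendPerm_one, Fin.succ_inj] using this
  subst hi
  have : τ = ρ := by
    ext x
    have := congrArg (fun σ : Equiv.Perm (Fin (m + 2)) => σ x.succ.succ) h
    simp only [extendPerm_succ_succ, Fin.succ_inj, Fin.succAbove_right_inj] at this
    rw [this]
  rw [this]

/-- The label 0 can be neither the second member of a pair nor the first member of a later pair.
Evenness of m puts every position into a pair. -/
lemma IsPairing.apply_zero (hm : Even m) {σ : Equiv.Perm (Fin (m + 2))} (h : IsPairing σ) :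
    σ 0 = 0 := by
  obtain ⟨j, hj⟩ := σ.surjective 0
  obtain ⟨r, hr⟩ := hm
  have hjl := j.isLt
  have hz : ∀ x : Fin (m + 2), ¬ x < 0 := fun x => Fin.not_lt_zero x
  rcases Nat.even_or_odd' (j : ℕ) with ⟨k, hk | hk⟩
  · rcases Nat.eq_zero_or_pos k with rfl | hk0
    · have : j = 0 := by ext; simpa using hk
      rw [← this, hj, this]
    · have := h.2 ⟨0, by omega⟩ ⟨k, by omega⟩ (by simpa using hk0)
      have e : (⟨2 * k, by omega⟩ : Fin (m + 2)) = j := by ext; exact hk.symm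
      simp only [e, hj] at this
      exact absurd this (hz _)
  · have := h.1 ⟨k, by omega⟩
    have e : (⟨2 * k + 1, by omega⟩ : Fin (m + 2)) = j := by ext; exact hk.symm
    simp only [e, hj] at this
    exact absurd this (hz _)

lemma extendPerm_mk_add_two (i : Fin (m + 1)) (τ : Equiv.Perm (Fin m)) (k : ℕ) (hk : k < m)
    (l : ℕ) (hl : l = k + 2) (h : l < m + 2) :
    extendPerm i τ ⟨l, h⟩ = (i.succAbove (τ ⟨k, hk⟩)).succ := by
  subst hl
  exact extendPerm_succ_succ i τ ⟨k, hk⟩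

/-- The conditions that involve position 0 hold because 0 is fixed; the others are those of τ, since
successor and `succAbove` are strictly increasing. -/
lemma isPairing_extendPerm (i : Fin (m + 1)) (τ : Equiv.Perm (Fin m)) :
    IsPairing (extendPerm i τ) ↔ IsPairing τ := by
  have hstep := fun (k : ℕ) (hk : k < m) l hl h => extendPerm_mk_add_two i τ k hk l hl h
  constructor
  · rintro ⟨h1, h2⟩
    refine ⟨fun k => ?_, fun k l hkl => ?_⟩
    · have := h1 ⟨k + 1, by omega⟩
      rw [hstep (2 * k) (by omega) _ (by simp; ring), hstep (2 * k + 1) (by omega) _ (by simp; ring)]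
        at this
      simpa using this
    · have := h2 ⟨k + 1, by omega⟩ ⟨l + 1, by omega⟩ (by simpa using hkl)
      rw [hstep (2 * k) (by omega) _ (by simp; ring), hstep (2 * l) (by omega) _ (by simp; ring)]
        at this
      simpa using this
  · rintro ⟨h1, h2⟩
    refine ⟨fun k => ?_, fun k l hkl => ?_⟩
    · obtain ⟨k, hk⟩ := k
      rcases k with _ | k
      · have e0 : extendPerm i τ ⟨2 * 0, by omega⟩ = 0 := extendPerm_zero i τ
        have e1 : extendPerm i τ ⟨2 * 0 + 1, by omega⟩ = i.succ := extendPerm_one i τ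
        simp only [e0, e1]
        exact Fin.succ_pos i
      · have := h1 ⟨k, by omega⟩
        simp only
        rw [hstep (2 * k) (by omega) _ (by ring), hstep (2 * k + 1) (by omega) _ (by ring)]
        simpa using this
    · obtain ⟨k, hk⟩ := k
      obtain ⟨l, hl⟩ := l
      have hkl' : k < l := hkl
      rcases l with _ | l
      · omega
      · simp only
        rw [hstep (2 * l) (by omega) (2 * (l + 1)) (by ring)]
        rcases k with _ | k
        · have e0 : extendPerm i τ ⟨2 * 0, by omega⟩ = 0 := extendPerm_zero i τ
          rw [e0]
          exact Fin.succ_pos _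
        · rw [hstep (2 * k) (by omega) (2 * (k + 1)) (by ring)]
          have := h2 ⟨k, by omega⟩ ⟨l, by omega⟩ (by simpa using hkl')
          simpa using this

lemma prod_pairs_extendPerm (A : Matrix (Fin (m + 2)) (Fin (m + 2)) R) (i : Fin (m + 1))
    (τ : Equiv.Perm (Fin m)) :
    ∏ k : Fin ((m + 2) / 2), A (extendPerm i τ ⟨2 * k, by omega⟩)
        (extendPerm i τ ⟨2 * k + 1, by omega⟩) =
      A 0 i.succ * ∏ k : Fin (m / 2), A (i.succAbove (τ ⟨2 * k, by omega⟩)).succ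
        (i.succAbove (τ ⟨2 * k + 1, by omega⟩)).succ := by
  have h : m / 2 + 1 = (m + 2) / 2 := by omega
  rw [← Fin.prod_congr' _ h, Fin.prod_univ_succ]
  congr 1
  · have e0 : extendPerm i τ ⟨2 * 0, by omega⟩ = 0 := extendPerm_zero i τ
    have e1 : extendPerm i τ ⟨2 * 0 + 1, by omega⟩ = i.succ := extendPerm_one i τ
    simp only [Fin.val_cast, Fin.val_zero, e0, e1]
  · refine prod_congr rfl fun k _ => ?_
    rw [extendPerm_mk_add_two i τ (2 * k) (by omega) _ (by simp; ring),
      extendPerm_mk_add_two i τ (2 * k + 1) (by omega) _ (by simp; ring)]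

/-- Expansion of a Pfaffian along its first row. -/
lemma pf_add_two (A : Matrix (Fin (m + 2)) (Fin (m + 2)) R) :
    pf A = ∑ i : Fin (m + 1), (-1) ^ (i : ℕ) * A 0 i.succ *
      pf (A.submatrix (fun x => (i.succAbove x).succ) (fun x => (i.succAbove x).succ)) := by
  classical
  by_cases hm : Even m
  · have hm2 : Even (m + 2) := by simpa [Nat.even_add] using hm
    simp only [pf, if_pos hm, if_pos hm2, mul_sum]
    rw [← sum_product' (f := fun (i : Fin (m + 1)) (τ : Equiv.Perm (Fin m)) =>
      (-1) ^ (i : ℕ) * A 0 i.succ * (((Equiv.Perm.sign τ : ℤ) : R) *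
        ∏ k : Fin (m / 2), A.submatrix (fun x => (i.succAbove x).succ)
          (fun x => (i.succAbove x).succ) (τ ⟨2 * k, by omega⟩) (τ ⟨2 * k + 1, by omega⟩)))]
    symm
    -- A pairing is the partner of 0 together with a pairing of the remaining positions.
    refine sum_bij (fun x _ => extendPerm x.1 x.2) ?_ ?_ ?_ ?_
    · rintro ⟨i, τ⟩ h
      simpa [isPairing_extendPerm] using h
    · intro x _ y _ h
      exact extendPerm_injective h
    · intro σ hσ
      have hσ' : IsPairing σ := by simpa using hσ
      obtain ⟨i, τ, rfl⟩ := exists_extendPerm σ (hσ'.apply_zero hm)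
      exact ⟨(i, τ), by simpa [isPairing_extendPerm] using hσ', rfl⟩
    · rintro ⟨i, τ⟩ _
      simp only [sign_extendPerm, Matrix.submatrix_apply]
      rw [prod_pairs_extendPerm]
      push_cast
      ring
  · have hm2 : ¬ Even (m + 2) := by simpa [Nat.even_add] using hm
    simp [pf, if_neg hm, if_neg hm2]

lemma pf_zero (A : Matrix (Fin 0) (Fin 0) R) : pf A = 1 := by
  classical
  have : (univ.filter fun σ : Equiv.Perm (Fin 0) => IsPairing σ) = univ := by
    refine filter_true_of_mem fun σ _ => ⟨fun k => ?_, fun k => ?_⟩ <;> exact absurd k.2 (by simp)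
  rw [pf, if_pos Even.zero, this]
  simp

lemma pf_of_odd (A : Matrix (Fin m) (Fin m) R) (h : ¬ Even m) : pf A = 0 := by
  simp [pf, h]

end PfaffianRecursion

/-! ### Pfaffians of submatrices with arbitrary ordered labels. -/

section SubPfaffian

variable {R : Type*} [CommRing R] {ι κ : Type*} [LinearOrder ι] [LinearOrder κ]

lemma subPf_eq_pf (A : Matrix ι ι R) (I : Finset ι) {k : ℕ} (hk : I.card = k) (f : Fin k → ι)
    (hf : ∀ x, f x ∈ I) (hmono : StrictMono f) : subPf A I = pf (A.submatrix f f) := by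
  subst hk
  rw [orderEmbOfFin_unique rfl hf hmono, subPf]

lemma subPf_empty (A : Matrix ι ι R) : subPf A ∅ = 1 := pf_zero _

lemma subPf_of_odd (A : Matrix ι ι R) {I : Finset ι} (h : ¬ Even I.card) : subPf A I = 0 :=
  pf_of_odd _ h

lemma card_filter_lt_orderEmbOfFin (S : Finset ι) {k : ℕ} (h : S.card = k) (i : Fin k) :
    (S.filter (· < S.orderEmbOfFin h i)).card = i := by
  have : S.filter (· < S.orderEmbOfFin h i) =
      (univ.filter (· < i)).map (S.orderEmbOfFin h).toEmbedding := by
    ext x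
    simp only [mem_filter, mem_map, mem_univ, true_and, RelEmbedding.coe_toEmbedding]
    constructor
    · rintro ⟨hx, hlt⟩
      have : x ∈ Set.range (S.orderEmbOfFin h) := by rw [range_orderEmbOfFin]; exact hx
      obtain ⟨j, rfl⟩ := this
      exact ⟨j, by simpa using hlt, rfl⟩
    · rintro ⟨j, hj, rfl⟩
      exact ⟨orderEmbOfFin_mem _ _ _, by simpa using hj⟩
  rw [this, card_map, ← Fin.card_Iio i]
  congr 1
  ext x
  simp

/-- Expansion of a Pfaffian along the row of the smallest label. -/
lemma subPf_insert (A : Matrix ι ι R) {a : ι} {S : Finset ι} (ha : ∀ x ∈ S, a < x) :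
    subPf A (insert a S) =
      ∑ b ∈ S, (-1) ^ (S.filter (· < b)).card * A a b * subPf A (S.erase b) := by
  have haS : a ∉ S := fun h => lt_irrefl _ (ha a h)
  obtain ⟨k, hk⟩ : ∃ k, S.card = k := ⟨_, rfl⟩
  rcases k with _ | m
  · rw [card_eq_zero] at hk
    subst hk
    rw [sum_empty]
    exact subPf_of_odd _ (by simp)
  set f : Fin (m + 1) ↪o ι := S.orderEmbOfFin hk with hf
  have hcons : StrictMono (Fin.cons a f : Fin (m + 2) → ι) := by
    refine Fin.strictMono_iff_lt_succ.2 fun i => ?_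
    refine Fin.cases ?_ (fun j => ?_) i
    · simpa using ha _ (orderEmbOfFin_mem S hk 0)
    · rw [← Fin.succ_castSucc]
      simp
  rw [subPf_eq_pf A (insert a S) (k := m + 2) (by rw [card_insert_of_notMem haS, hk])
    (Fin.cons a f) (fun x => ?_) hcons, pf_add_two]
  · symm
    have hS : S = univ.map f.toEmbedding := by
      ext x
      have := congrArg (x ∈ ·) (range_orderEmbOfFin S hk)
      simp only [Set.mem_range, SetLike.mem_coe, eq_iff_iff] at this
      simp [← this, hf]
    have hsum : ∀ g : ι → R, ∑ b ∈ S, g b = ∑ i, g (f i) := fun g => by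
      conv_lhs => rw [hS, sum_map]
      rfl
    rw [hsum]
    refine sum_congr rfl fun i _ => ?_
    rw [card_filter_lt_orderEmbOfFin]
    refine congrArg₂ _ rfl ?_
    rw [subPf_eq_pf A (S.erase (f i)) (k := m)
      (by rw [card_erase_of_mem (orderEmbOfFin_mem S hk i), hk]; rfl)
      (fun x => f (i.succAbove x)) (fun x => ?_) (fun x y hxy => ?_)]
    · rfl
    · rw [mem_erase]
      exact ⟨fun h => Fin.succAbove_ne i x (f.injective h), orderEmbOfFin_mem S hk _⟩
    · simpa using hxy
  · refine Fin.cases ?_ (fun j => ?_) x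
    · simp
    · simp [hf]

lemma subPf_univ {n : ℕ} (A : Matrix (Fin n) (Fin n) R) : subPf A univ = pf A := by
  rw [subPf_eq_pf A univ (k := n) (by simp) id (by simp) strictMono_id]
  rfl

/-- The Pfaffian is natural in the labels. -/
lemma subPf_map (f : κ ↪o ι) (A : Matrix ι ι R) (I : Finset κ) :
    subPf A (I.map f.toEmbedding) = subPf (A.submatrix f f) I := by
  rw [subPf_eq_pf A (I.map f.toEmbedding) (k := I.card) (by simp)
    (fun x => f (I.orderEmbOfFin rfl x)) (fun x => ?_) (fun x y hxy => ?_), subPf]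
  · rfl
  · simp
  · simpa using hxy

end SubPfaffian

/-! ### Pfaffians of sums, of checkerboard flips and of noncrossing direct sums. -/

section PfaffianIdentities

variable {R : Type*} [CommRing R]

lemma neg_one_pow_congr {k l : ℕ} (h : k % 2 = l % 2) : (-1 : R) ^ k = (-1) ^ l := by
  rw [neg_one_pow_eq_pow_mod_two k, h, ← neg_one_pow_eq_pow_mod_two]

variable {ι : Type*} [LinearOrder ι]

lemma card_filter_lt_split (S I : Finset ι) (hI : I ⊆ S) (b : ι) :
    (S.filter (· < b)).card = (I.filter (· < b)).card + ((S \ I).filter (· < b)).card := by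
  rw [← card_union_of_disjoint]
  · congr 1
    ext x
    have := @hI x
    simp only [mem_filter, mem_union, mem_sdiff]
    tauto
  · rw [disjoint_left]
    simp only [mem_filter, mem_sdiff]
    tauto

lemma card_eq_filter_lt_add_filter_gt (J : Finset ι) {b : ι} (hb : b ∉ J) :
    J.card = (J.filter (· < b)).card + (J.filter (b < ·)).card := by
  rw [← card_union_of_disjoint]
  · congr 1
    ext x
    simp only [mem_union, mem_filter, ← and_or_left]
    refine ⟨fun h => ⟨h, lt_or_gt_of_ne fun e => hb (e ▸ h)⟩, fun h => h.1⟩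
  · rw [disjoint_left]
    simp only [mem_filter]
    exact fun x h h' => lt_asymm h.2 h'.2

/-- The Pfaffian of a sum of two matrices. -/
theorem subPf_add (A B : Matrix ι ι R) (S : Finset ι) :
    subPf (A + B) S = ∑ I ∈ S.powerset,
      (-1) ^ (∑ j ∈ S \ I, (I.filter (· < j)).card) * subPf A I * subPf B (S \ I) := by
  induction hN : S.card using Nat.strong_induction_on generalizing S with
  | _ N ih =>
  subst hN
  rcases S.eq_empty_or_nonempty with rfl | hS
  · simp [subPf_empty]
  obtain ⟨a, S₀, ha, rfl⟩ : ∃ a S₀, (∀ x ∈ S₀, a < x) ∧ S = insert a S₀ := by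
    refine ⟨S.min' hS, S.erase (S.min' hS), fun x hx => ?_, (insert_erase (min'_mem S hS)).symm⟩
    exact min'_lt_of_mem_erase_min' S hS hx
  have haS : a ∉ S₀ := fun h => lt_irrefl _ (ha a h)
  -- Both sides are split by the matrix that supplies the entry in row a: B when a ∉ I, and A when a
  -- ∈ I. The exponent counts pairs i < j with i ∈ I and j ∉ I; with this convention the parities
  -- agree in every term, without |I| being even.
  rw [subPf_insert _ ha, sum_powerset_insert haS]
  have hrec : ∀ b ∈ S₀, (-1) ^ (S₀.filter (· < b)).card * (A + B) a b * subPf (A + B) (S₀.erase b) =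
      (∑ I ∈ (S₀.erase b).powerset, (-1) ^ (S₀.filter (· < b)).card * B a b *
        ((-1) ^ (∑ j ∈ S₀.erase b \ I, (I.filter (· < j)).card) * subPf A I *
          subPf B (S₀.erase b \ I))) +
      ∑ I ∈ (S₀.erase b).powerset, (-1) ^ (S₀.filter (· < b)).card * A a b *
        ((-1) ^ (∑ j ∈ S₀.erase b \ I, (I.filter (· < j)).card) * subPf A I *
          subPf B (S₀.erase b \ I)) := by
    intro b hb
    rw [ih _ ?_ (S₀.erase b) rfl, ← mul_sum, ← mul_sum, Matrix.add_apply]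
    · ring
    · rw [card_insert_of_notMem haS, card_erase_of_mem hb]
      omega
  rw [sum_congr rfl hrec, sum_add_distrib]
  congr 1
  -- Entry from B: the partner b lies outside I, and for fixed I the sum over b is a row expansion
  -- of `subPf B`.
  · rw [sum_comm' (t' := S₀.powerset) (s' := fun I => S₀ \ I)]
    · refine sum_congr rfl fun I hI => ?_
      rw [mem_powerset] at hI
      have haI : a ∉ I := fun h => haS (hI h)
      rw [insert_sdiff_of_notMem _ haI, subPf_insert _ (fun x hx => ha x (mem_sdiff.1 hx).1),
        mul_sum, sum_insert (by simp [haS])]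
      refine sum_congr rfl fun b hb => ?_
      rw [erase_sdiff_comm]
      have h0 : (I.filter (· < a)).card = 0 := by
        rw [card_eq_zero, filter_eq_empty_iff]
        exact fun x hx => not_lt.2 (ha x (hI hx)).le
      have hs := card_filter_lt_split S₀ I hI b
      have he : ∑ j ∈ S₀ \ I, (I.filter (· < j)).card =
          (I.filter (· < b)).card + ∑ j ∈ (S₀ \ I).erase b, (I.filter (· < j)).card :=
        (add_sum_erase _ _ hb).symm
      have : (-1 : R) ^ (S₀.filter (· < b)).card *
          (-1) ^ (∑ j ∈ (S₀ \ I).erase b, (I.filter (· < j)).card) =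
          (-1) ^ ((I.filter (· < a)).card + ∑ j ∈ S₀ \ I, (I.filter (· < j)).card) *
            (-1) ^ ((S₀ \ I).filter (· < b)).card := by
        rw [← pow_add, ← pow_add]
        apply neg_one_pow_congr
        omega
      linear_combination B a b * subPf A I * subPf B ((S₀ \ I).erase b) * this
    · intro b I
      simp only [mem_powerset, mem_sdiff, subset_erase]
      tauto
  · have hexp : ∀ I ∈ S₀.powerset,
        (-1) ^ (∑ j ∈ insert a S₀ \ insert a I, ((insert a I).filter (· < j)).card) *
          subPf A (insert a I) * subPf B (insert a S₀ \ insert a I) =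
        ∑ b ∈ I, (-1) ^ (∑ j ∈ S₀ \ I, ((insert a I).filter (· < j)).card) *
          ((-1) ^ (I.filter (· < b)).card * A a b * subPf A (I.erase b)) * subPf B (S₀ \ I) := by
      intro I hI
      rw [mem_powerset] at hI
      have : insert a S₀ \ insert a I = S₀ \ I := by
        ext x
        simp only [mem_sdiff, mem_insert]
        have : x ∈ S₀ → x ≠ a := fun h e => haS (e ▸ h)
        tauto
      rw [this, subPf_insert _ (fun x hx => ha x (hI hx)), mul_sum, sum_mul]
    rw [sum_congr rfl hexp, sum_sigma', sum_sigma']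
    -- Entry from A: the partner b belongs to the part of A, so it is put back into I.
    refine sum_bij' (fun x _ => ⟨insert x.1 x.2, x.1⟩) (fun x _ => ⟨x.2, x.1.erase x.2⟩)
      ?_ ?_ ?_ ?_ ?_
    · rintro ⟨b, I⟩ h
      simp only [mem_sigma, mem_powerset, subset_erase] at h
      simp only [mem_sigma, mem_powerset, mem_insert_self, and_true]
      exact insert_subset h.1 h.2.1
    · rintro ⟨I, b⟩ h
      simp only [mem_sigma, mem_powerset] at h
      simp only [mem_sigma, mem_powerset]
      exact ⟨h.1 h.2, erase_subset_erase _ h.1⟩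
    · rintro ⟨b, I⟩ h
      simp only [mem_sigma, mem_powerset, subset_erase] at h
      simp [erase_insert h.2.2]
    · rintro ⟨I, b⟩ h
      simp only [mem_sigma, mem_powerset] at h
      simp [insert_erase h.2]
    · rintro ⟨b, I⟩ h
      simp only [mem_sigma, mem_powerset, subset_erase] at h
      obtain ⟨hb, hI, hbI⟩ := h
      have hJ : S₀.erase b \ I = S₀ \ insert b I := by
        ext x
        simp only [mem_sdiff, mem_erase, mem_insert]
        tauto
      simp only [hJ, erase_insert hbI]
      set J := S₀ \ insert b I with hJdef
      have hbJ : b ∉ J := by simp [hJdef]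
      have hs := card_filter_lt_split S₀ (insert b I) (insert_subset hb hI) b
      rw [← hJdef] at hs
      have hsplit := card_eq_filter_lt_add_filter_gt J hbJ
      -- Adding a contributes one for every j in J, and adding b one for every j above b.
      have hsum : ∑ j ∈ J, ((insert a (insert b I)).filter (· < j)).card =
          J.card + ∑ j ∈ J, (I.filter (· < j)).card + (J.filter (b < ·)).card := by
        rw [card_eq_sum_ones, card_filter, ← sum_add_distrib, ← sum_add_distrib]
        refine sum_congr rfl fun j hj => ?_
        have hj' : j ∈ S₀ := (mem_sdiff.1 hj).1
        have haj := ha j hj'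
        have ha' : a ∉ insert b I := fun h => haS (insert_subset hb hI h)
        rw [filter_insert, if_pos haj, card_insert_of_notMem (by simp [ha']), filter_insert]
        split_ifs with h
        · rw [card_insert_of_notMem (by simp [hbI])]
          omega
        · omega
      have : (-1 : R) ^ (S₀.filter (· < b)).card * (-1) ^ (∑ j ∈ J, (I.filter (· < j)).card) =
          (-1) ^ (∑ j ∈ J, ((insert a (insert b I)).filter (· < j)).card) *
            (-1) ^ ((insert b I).filter (· < b)).card := by
        rw [← pow_add, ← pow_add, hsum]
        apply neg_one_pow_congr
        omega
      linear_combination A a b * subPf A I * subPf B J * this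

/-- Each term of the Pfaffian uses every label of J once, which gives the sign with exponent |J|/2
plus the sum of the labels. The ranks within J add up to |J|(|J|-1)/2, which has the parity of |J|/2
for even |J|; in this form the exponent combines with that of `subPf_add`. -/
lemma subPf_checkerboard {n : ℕ} (B : Matrix (Fin n) (Fin n) R) (J : Finset (Fin n)) :
    subPf (checkerboard B) J =
      (-1) ^ (∑ j ∈ J, ((j : ℕ) + (J.filter (· < j)).card)) * subPf B J := by
  induction hN : J.card using Nat.strong_induction_on generalizing J with
  | _ N ih =>
  subst hN
  rcases J.eq_empty_or_nonempty with rfl | hJ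
  · simp [subPf_empty]
  obtain ⟨a, S, ha, rfl⟩ : ∃ a S, (∀ x ∈ S, a < x) ∧ J = insert a S := by
    refine ⟨J.min' hJ, J.erase (J.min' hJ), fun x hx => ?_, (insert_erase (min'_mem J hJ)).symm⟩
    exact min'_lt_of_mem_erase_min' J hJ hx
  have haS : a ∉ S := fun h => lt_irrefl _ (ha a h)
  rw [subPf_insert _ ha, subPf_insert _ ha, mul_sum]
  refine sum_congr rfl fun b hb => ?_
  rw [ih _ ?_ (S.erase b) rfl]
  · have hab := ha b hb
    have hsplit := card_eq_filter_lt_add_filter_gt (S.erase b) (notMem_erase b S)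
    have hlow : (S.filter (· < b)).card = ((S.erase b).filter (· < b)).card := by
      congr 1
      ext x
      simp only [mem_filter, mem_erase]
      exact ⟨fun h => ⟨⟨h.2.ne, h.1⟩, h.2⟩, fun h => ⟨h.1.2, h.2⟩⟩
    have hna : ∀ j ∈ S, ((insert a S).filter (· < j)).card = (S.filter (· < j)).card + 1 := by
      intro j hj
      rw [filter_insert, if_pos (ha j hj), card_insert_of_notMem (by simp [haS])]
    have h0 : ((insert a S).filter (· < a)).card = 0 := by
      rw [card_eq_zero, filter_eq_empty_iff]
      intro x hx
      rcases mem_insert.1 hx with rfl | hx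
      · exact lt_irrefl _
      · exact not_lt.2 (ha x hx).le
    have hsum : ∑ j ∈ S.erase b, ((j : ℕ) + ((insert a S).filter (· < j)).card) =
        ∑ j ∈ S.erase b, ((j : ℕ) + ((S.erase b).filter (· < j)).card) + (S.erase b).card +
          ((S.erase b).filter (b < ·)).card := by
      rw [card_eq_sum_ones (S.erase b), card_filter, ← sum_add_distrib, ← sum_add_distrib]
      refine sum_congr rfl fun j hj => ?_
      rw [hna j (mem_of_mem_erase hj), filter_erase]
      split_ifs with h
      · have := card_erase_add_one (mem_filter.2 ⟨hb, h⟩ : b ∈ S.filter (· < j))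
        omega
      · rw [erase_eq_of_notMem (by simp [h])]
        omega
    have htot : ∑ j ∈ insert a S, ((j : ℕ) + ((insert a S).filter (· < j)).card) =
        a + (b + ((S.filter (· < b)).card + 1) +
          ∑ j ∈ S.erase b, ((j : ℕ) + ((insert a S).filter (· < j)).card)) := by
      rw [sum_insert haS, h0, ← add_sum_erase _ _ hb, hna b hb, add_zero]
    have : (-1 : R) ^ ((a : ℕ) + (b : ℕ) + 1) *
        (-1) ^ (∑ j ∈ S.erase b, ((j : ℕ) + ((S.erase b).filter (· < j)).card)) =
        (-1) ^ (∑ j ∈ insert a S, ((j : ℕ) + ((insert a S).filter (· < j)).card)) := by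
      rw [← pow_add, htot, hsum]
      apply neg_one_pow_congr
      omega
    rw [checkerboard]
    linear_combination (-1) ^ (S.filter (· < b)).card * B a b * subPf B (S.erase b) * this
  · rw [card_insert_of_notMem haS, card_erase_of_mem hb]
    omega

/-- The contraction of `sPf A` with `sPf^∨ B` is the Pfaffian of `A + B̃`. -/
theorem pf_add_checkerboard {n : ℕ} (A B : Matrix (Fin n) (Fin n) R) :
    pf (A + checkerboard B) = ∑ I : Finset (Fin n), subPf A I * subPf B Iᶜ := by
  rw [← subPf_univ, subPf_add, powerset_univ]
  refine sum_congr rfl fun I _ => ?_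
  rw [← compl_eq_univ_sdiff, subPf_checkerboard]
  -- Exactly j labels lie below j, each in I or in its complement, so the total exponent is even.
  have hj : ∀ j ∈ Iᶜ, (I.filter (· < j)).card + ((j : ℕ) + (Iᶜ.filter (· < j)).card) =
      2 * (j : ℕ) := by
    intro j _
    have := card_filter_lt_split univ I (subset_univ _) j
    rw [← compl_eq_univ_sdiff] at this
    have h2 : ((univ : Finset (Fin n)).filter (· < j)).card = j := by
      rw [← Fin.card_Iio j]
      congr 1
      ext x
      simp
    omega
  have : (-1 : R) ^ (∑ j ∈ Iᶜ, (I.filter (· < j)).card) *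
      (-1) ^ (∑ j ∈ Iᶜ, ((j : ℕ) + (Iᶜ.filter (· < j)).card)) = 1 := by
    rw [← pow_add, ← sum_add_distrib, sum_congr rfl hj, ← mul_sum, pow_mul]
    simp
  linear_combination subPf A I * subPf B Iᶜ * this

/-- No two classes of the colouring `c` cross. -/
def Noncrossing {γ : Type*} (c : ι → γ) : Prop :=
  ∀ i j k l, i < j → j < k → k < l → c i = c k → c j = c l → c i = c j

/-- The Pfaffian of a direct sum of blocks whose label sets do not cross. -/
theorem subPf_direct_sum {γ : Type*} [Fintype γ] [DecidableEq γ] {c : ι → γ} (hc : Noncrossing c)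
    (A : Matrix ι ι R) (hA : ∀ i j, c i ≠ c j → A i j = 0) (S : Finset ι) :
    subPf A S = ∏ g, subPf A (S.filter fun i => c i = g) := by
  induction hN : S.card using Nat.strong_induction_on generalizing S with
  | _ N ih =>
  subst hN
  rcases S.eq_empty_or_nonempty with rfl | hS
  · simp [subPf_empty]
  obtain ⟨a, S₀, ha, rfl⟩ : ∃ a S₀, (∀ x ∈ S₀, a < x) ∧ S = insert a S₀ := by
    refine ⟨S.min' hS, S.erase (S.min' hS), fun x hx => ?_, (insert_erase (min'_mem S hS)).symm⟩
    exact min'_lt_of_mem_erase_min' S hS hx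
  have haS : a ∉ S₀ := fun h => lt_irrefl _ (ha a h)
  rw [subPf_insert _ ha, ← mul_prod_erase univ _ (mem_univ (c a)), filter_insert, if_pos rfl,
    subPf_insert _ fun x hx => ha x (mem_filter.1 hx).1, sum_mul, sum_filter]
  -- The two expansions differ only in the sign at b: one counts all labels below b, the other those
  -- in the class of a.
  refine sum_congr rfl fun b hb => ?_
  split_ifs with hcb
  · rw [ih _ ?_ (S₀.erase b) rfl, ← mul_prod_erase univ _ (mem_univ (c a)), filter_erase]
    · have hother : ∀ g ∈ univ.erase (c a),
          (S₀.erase b).filter (fun i => c i = g) = (insert a S₀).filter fun i => c i = g := by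
        intro g hg
        have hg' : g ≠ c a := (mem_erase.1 hg).1
        rw [filter_insert, if_neg hg'.symm, filter_erase, erase_eq_of_notMem]
        simp only [mem_filter, not_and]
        exact fun _ h => hg' (by rw [← h, hcb])
      rw [prod_congr rfl fun g hg => by rw [hother g hg]]
      -- If another class has odd size, its factor makes both sides vanish. Otherwise each other
      -- class has an even number of labels below b: none, or all of them.
      by_cases heven : ∀ g ∈ univ.erase (c a), Even (((insert a S₀).filter fun i => c i = g).card)
      · have hsum : (S₀.filter (· < b)).card =
            ((S₀.filter fun i => c i = c a).filter (· < b)).card +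
              ∑ g ∈ univ.erase (c a), ((S₀.filter fun i => c i = g).filter (· < b)).card := by
          rw [add_sum_erase univ (fun g => ((S₀.filter fun i => c i = g).filter (· < b)).card)
            (mem_univ (c a)), card_eq_sum_card_fiberwise (t := univ) (f := c) (by simp)]
          simp only [filter_filter, and_comm]
        have hev : Even (∑ g ∈ univ.erase (c a),
            ((S₀.filter fun i => c i = g).filter (· < b)).card) := by
          refine even_sum _ fun g hg => ?_
          have hg' : g ≠ c a := (mem_erase.1 hg).1
          by_cases hx : ∃ x ∈ S₀, c x = g ∧ x < b
          · obtain ⟨x, hxS, hxg, hxb⟩ := hx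
            have h := heven g hg
            rw [filter_insert, if_neg hg'.symm] at h
            rw [filter_true_of_mem]
            · exact h
            · intro y hy
              rw [mem_filter] at hy
              by_contra hby
              have hne : y ≠ b := by
                rintro rfl
                exact hg' (by rw [← hy.2, hcb])
              have hby' : b < y := lt_of_le_of_ne (not_lt.1 hby) hne.symm
              -- A class with labels x < b < y would cross the class of a and b.
              have := hc a x b y (ha x hxS) hxb hby' hcb.symm (by rw [hxg, hy.2])
              exact hg' (by rw [← hxg, this])
          · rw [filter_false_of_mem]
            · simp
            · intro y hy hyb
              rw [mem_filter] at hy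
              exact hx ⟨y, hy.1, hy.2, hyb⟩
        have : (-1 : R) ^ (S₀.filter (· < b)).card =
            (-1) ^ ((S₀.filter fun i => c i = c a).filter (· < b)).card := by
          rw [hsum, pow_add, hev.neg_one_pow, mul_one]
        rw [this]
        ring
      · push Not at heven
        obtain ⟨g, hg, hodd⟩ := heven
        rw [prod_eq_zero hg (subPf_of_odd _ hodd)]
        simp
    · rw [card_insert_of_notMem haS, card_erase_of_mem hb]
      omega
  · rw [hA a b (fun h => hcb h.symm)]
    simp

end PfaffianIdentities

/-! ### The contraction as a Pfaffian, for noncrossing edge orders. -/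

section Contraction

variable {F : Type*} [Field F]

/-- Every edge lies in exactly one class, so independent bitstrings on the classes amount to one
bitstring on all edges. -/
lemma prod_sum_fibers {E γ : Type*} [Fintype E] [DecidableEq E] [Fintype γ] [DecidableEq γ]
    (c : E → γ) (W : E → Fin 2 → F) (G : ∀ g, ({e // c e = g} → Fin 2) → F) :
    ∏ g, ∑ x : {e // c e = g} → Fin 2, (∏ e : {e // c e = g}, W e (x e)) * G g x =
      ∑ x : E → Fin 2, (∏ e, W e (x e)) * ∏ g, G g fun e => x e := by
  rw [prod_univ_sum, Fintype.piFinset_univ]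
  let φ : (E → Fin 2) ≃ (∀ g, {e // c e = g} → Fin 2) :=
    { toFun := fun x _ e => x e
      invFun := fun p e => p (c e) ⟨e, rfl⟩
      left_inv := fun x => rfl
      right_inv := fun p => by
        funext g ⟨e, he⟩
        subst he
        rfl }
  rw [← φ.sum_comp]
  refine sum_congr rfl fun x _ => ?_
  rw [prod_mul_distrib, ← Fintype.prod_fiberwise c fun e => W e (x e)]
  rfl

/-- Each edge meets one gate and one cogate, so summing over y multiplies A⁻¹ by A at every edge and
forces x' = x. -/
lemma Circuit.value_eq_sum_after {M : PlanarGraph} (C : Circuit F M) :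
    C.value = ∑ y : Fin M.n → Fin 2,
      (∏ g, C.gateAfter g fun e => y e) * ∏ c, C.cogateAfter c fun e => y e := by
  have hG : ∀ y : Fin M.n → Fin 2, ∏ g, C.gateAfter g (fun e => y e) =
      ∑ x : Fin M.n → Fin 2, (∏ e, (C.basis e).val (y e) (x e)) *
        ∏ g, C.gateTensor g fun e => x e := fun y =>
    prod_sum_fibers M.gate (fun e => (C.basis e).val (y e)) C.gateTensor
  have hJ : ∀ y : Fin M.n → Fin 2, ∏ c, C.cogateAfter c (fun e => y e) =
      ∑ x : Fin M.n → Fin 2, (∏ e, ((C.basis e)⁻¹).val.transpose (y e) (x e)) *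
        ∏ c, C.cogateTensor c fun e => x e := fun y =>
    prod_sum_fibers M.cogate (fun e => ((C.basis e)⁻¹).val.transpose (y e)) C.cogateTensor
  have key : ∀ x x' : Fin M.n → Fin 2,
      ∑ y : Fin M.n → Fin 2, (∏ e, (C.basis e).val (y e) (x e)) *
        (∏ e, ((C.basis e)⁻¹).val.transpose (y e) (x' e)) = if x' = x then 1 else 0 := by
    intro x x'
    simp only [← prod_mul_distrib]
    have := (prod_univ_sum (fun _ : Fin M.n => (univ : Finset (Fin 2))) fun e s =>
      (C.basis e).val s (x e) * ((C.basis e)⁻¹).val.transpose s (x' e)).symm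
    rw [Fintype.piFinset_univ] at this
    rw [this]
    have he : ∀ e, ∑ s, (C.basis e).val s (x e) * ((C.basis e)⁻¹).val.transpose s (x' e) =
        if x' e = x e then 1 else 0 := by
      intro e
      have h1 : ((C.basis e)⁻¹).val * (C.basis e).val = 1 := (C.basis e).inv_val
      have h2 := congrFun (congrFun h1 (x' e)) (x e)
      rw [Matrix.mul_apply, Matrix.one_apply] at h2
      rw [← h2]
      refine sum_congr rfl fun s _ => ?_
      rw [Matrix.transpose_apply, mul_comm]
    simp only [he, prod_ite_zero]
    simp [funext_iff]
  simp only [hG, hJ, sum_mul_sum]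
  rw [sum_comm, Circuit.value]
  refine sum_congr rfl fun x _ => ?_
  rw [sum_comm]
  have hinner : ∀ x' : Fin M.n → Fin 2,
      ∑ y : Fin M.n → Fin 2, ((∏ e, (C.basis e).val (y e) (x e)) *
        ∏ g, C.gateTensor g fun e => x e) *
        ((∏ e, ((C.basis e)⁻¹).val.transpose (y e) (x' e)) * ∏ c, C.cogateTensor c fun e => x' e) =
      if x' = x then (∏ g, C.gateTensor g fun e => x e) * ∏ c, C.cogateTensor c fun e => x' e
        else 0 := by
    intro x'
    rw [← boole_mul, ← key x x', sum_mul]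
    exact sum_congr rfl fun y _ => by ring
  simp only [hinner]
  simp

variable {M : PlanarGraph} {o : Equiv.Perm (Fin M.n)} (D : PfaffianData F M o)

/-- The inclusion of the labels of one gate preserves their order, so the coefficients at all gates
become sub-Pfaffians of one common matrix. -/
lemma PfaffianData.sPf_block (g : Fin M.p) (z : Fin M.n → Fin 2) :
    sPf (D.Ξ g) (fun i => z i.1) =
      subPf D.sumΞ ((univ.filter fun i => z i = 1).filter fun i => M.gate (o i) = g) := by
  have hsub : D.Ξ g = D.sumΞ.submatrix (OrderEmbedding.subtype fun i => M.gate (o i) = g)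
      (OrderEmbedding.subtype fun i => M.gate (o i) = g) := by
    ext ⟨i, hi⟩ ⟨j, hj⟩
    subst hj
    simp [PfaffianData.sumΞ, hi]
  rw [sPf, hsub, ← subPf_map]
  congr 1
  ext i
  simp [and_comm]

lemma PfaffianData.sPfDual_block (c : Fin M.q) (z : Fin M.n → Fin 2) :
    sPfDual (D.Θ c) (fun i => z i.1) =
      subPf D.sumΘ ((univ.filter fun i => z i = 1)ᶜ.filter fun i => M.cogate (o i) = c) := by
  have hsub : D.Θ c = D.sumΘ.submatrix (OrderEmbedding.subtype fun i => M.cogate (o i) = c)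
      (OrderEmbedding.subtype fun i => M.cogate (o i) = c) := by
    ext ⟨i, hi⟩ ⟨j, hj⟩
    subst hj
    simp [PfaffianData.sumΘ, hi]
  rw [sPfDual, hsub, ← subPf_map]
  congr 1
  ext i
  simp [and_comm]

lemma sum_bitstrings_eq_sum_finset {n : ℕ} (f : Finset (Fin n) → F) :
    ∑ z : Fin n → Fin 2, f (univ.filter fun i => z i = 1) = ∑ I, f I := by
  refine sum_bij' (fun z _ => univ.filter fun i => z i = 1) (fun I _ i => if i ∈ I then 1 else 0)
    (by simp) (by simp) ?_ ?_ (by simp)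
  · intro z _
    funext i
    have : ∀ s : Fin 2, (if s = 1 then (1 : Fin 2) else 0) = s := by decide
    simpa using this (z i)
  · intro I _
    ext i
    simp

/-- The value of a Pfaffian circuit, for an edge order in which neither gates nor cogates cross. -/
theorem PfaffianData.Represents.value_eq {D : PfaffianData F M o} {C : Circuit F M}
    (h : D.Represents C) (hg : Noncrossing fun i => M.gate (o i))
    (hc : Noncrossing fun i => M.cogate (o i)) : C.value = D.γ * pf D.Ω := by
  have hblockΞ : ∀ i j, M.gate (o i) ≠ M.gate (o j) → D.sumΞ i j = 0 := fun i j hij => by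
    simp [PfaffianData.sumΞ, hij]
  have hblockΘ : ∀ i j, M.cogate (o i) ≠ M.cogate (o j) → D.sumΘ i j = 0 := fun i j hij => by
    simp [PfaffianData.sumΘ, hij]
  -- The last rewriting turns the sum over bits on edges into one over bits on labels.
  rw [C.value_eq_sum_after, PfaffianData.Ω, pf_add_checkerboard, ← sum_bitstrings_eq_sum_finset,
    mul_sum, ← (o.arrowCongr (Equiv.refl (Fin 2))).sum_comp]
  refine sum_congr rfl fun y _ => ?_
  rw [subPf_direct_sum hg D.sumΞ hblockΞ, subPf_direct_sum hc D.sumΘ hblockΘ]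
  simp only [h.1, h.2, prod_mul_distrib, PfaffianData.γ, Equiv.arrowCongr_apply,
    Function.comp_apply, Equiv.symm_apply_apply, Equiv.refl_apply, D.sPf_block, D.sPfDual_block]
  ring

end Contraction

/-! ### Cuts of trees, and how they exclude crossings. -/

section Cuts

lemma eq_of_reachable_fromRel {V α : Type*} {r : V → V → Prop} (f : V → α)
    (hf : ∀ u v, r u v → f u = f v) {u v : V} (h : (SimpleGraph.fromRel r).Reachable u v) :
    f u = f v := by
  obtain ⟨w⟩ := h
  induction w with
  | nil => rfl
  | cons hadj _ ih =>
    rw [← ih]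
    rw [SimpleGraph.fromRel_adj] at hadj
    rcases hadj.2 with h | h
    · exact hf _ _ h
    · exact (hf _ _ h).symm

lemma exists_rel_of_connected_fromRel {V : Type*} {r : V → V → Prop}
    (h : (SimpleGraph.fromRel r).Connected) {u v : V} (huv : u ≠ v) : ∃ w, r u w ∨ r w u := by
  obtain ⟨w⟩ := h.preconnected u v
  cases w with
  | nil => exact absurd rfl huv
  | cons hadj _ => exact ⟨_, ((SimpleGraph.fromRel_adj _ _ _).1 hadj).2⟩

variable {V E : Type*} [Fintype V] [Fintype E] [DecidableEq E]

/-- In a multigraph that is connected and has one edge less than it has vertices, every edge is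
the only one across some cut. -/
lemma exists_cut_of_tree (s t : E → V)
    (hconn : ∀ f : V → ℚ, (∀ e, f (s e) = f (t e)) → ∀ u v, f u = f v)
    (hcard : Fintype.card V = Fintype.card E + 1) (e : E) :
    ∃ f : V → ℚ, ∀ e', f (t e') - f (s e') = if e' = e then 1 else 0 := by
  -- The coboundary map. Connectedness makes its kernel at most one-dimensional, so by rank and
  -- nullity it is onto; the cut is a preimage of a unit vector.
  let d : (V → ℚ) →ₗ[ℚ] (E → ℚ) :=
    { toFun := fun f e => f (t e) - f (s e)
      map_add' := fun f g => by
        funext e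
        simp only [Pi.add_apply]
        ring
      map_smul' := fun c f => by
        funext e
        simp only [Pi.smul_apply, smul_eq_mul, RingHom.id_apply]
        ring }
  have hd : ∀ f e, d f e = f (t e) - f (s e) := fun _ _ => rfl
  have hker : Module.finrank ℚ (LinearMap.ker d) ≤ 1 := by
    have hle : LinearMap.ker d ≤ Submodule.span ℚ {fun _ => (1 : ℚ)} := by
      intro f hf
      rw [LinearMap.mem_ker] at hf
      have hf' : ∀ e, f (s e) = f (t e) := fun e => by
        have := congrFun hf e
        rw [hd, Pi.zero_apply, sub_eq_zero] at this
        exact this.symm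
      rw [Submodule.mem_span_singleton]
      have : 0 < Fintype.card V := by omega
      obtain ⟨v⟩ := Fintype.card_pos_iff.1 this
      refine ⟨f v, ?_⟩
      funext u
      simp [hconn f hf' u v]
    exact (Submodule.finrank_mono hle).trans
      ((finrank_span_le_card _).trans (by simp))
  have hsurj : LinearMap.range d = ⊤ := by
    apply Submodule.eq_top_of_finrank_eq
    have h1 := LinearMap.finrank_range_add_finrank_ker d
    have h2 := Submodule.finrank_le (LinearMap.range d)
    rw [Module.finrank_fintype_fun_eq_card] at h1 h2 ⊢
    omega
  obtain ⟨f, hf⟩ := LinearMap.range_eq_top.1 hsurj (Pi.single e 1)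
  refine ⟨f, fun e' => ?_⟩
  rw [← hd, hf, Pi.single_apply]

/-- Any two vertices of a tree are separated by a cut with a single edge. -/
lemma exists_separating_cut_of_tree (s t : E → V)
    (hconn : ∀ f : V → ℚ, (∀ e, f (s e) = f (t e)) → ∀ u v, f u = f v)
    (hcard : Fintype.card V = Fintype.card E + 1) {g h : V} (hgh : g ≠ h) :
    ∃ (f : V → ℚ) (e : E), f g ≠ f h ∧ ∀ e', e' ≠ e → f (s e') = f (t e') := by
  classical
  choose c hc using exists_cut_of_tree s t hconn hcard
  by_contra! hno
  have hsame : ∀ e, c e g = c e h := by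
    intro e
    by_contra hne
    obtain ⟨e', he', hne'⟩ := hno (c e) e hne
    have := hc e e'
    rw [if_neg he', sub_eq_zero] at this
    exact hne' this.symm
  -- Suppose that no cut separates g from h. Subtract from the indicator of g the combination of
  -- cuts with the same coboundary: the difference is constant, although only the indicator
  -- distinguishes g from h.
  let w : V → ℚ := fun v => if v = g then 1 else 0
  have := hconn (fun v => w v - ∑ e, (w (t e) - w (s e)) * c e v) (fun e => by
    have h1 : ∑ e', (w (t e') - w (s e')) * (c e' (t e) - c e' (s e)) = w (t e) - w (s e) := by
      simp [hc]
    simp only [mul_sub, sum_sub_distrib] at h1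
    linarith) g h
  simp only [hsame] at this
  have h2 : w g = w h := by linarith
  simp [w, hgh.symm] at h2

lemma exists_change {α : Type*} (u : ℕ → α) {i j : ℕ} (hij : i ≤ j) (h : u i ≠ u j) :
    ∃ x, i ≤ x ∧ x < j ∧ u x ≠ u (x + 1) := by
  induction j, hij using Nat.le_induction with
  | base => exact absurd rfl h
  | succ j hij ih =>
    by_cases h' : u i = u j
    · exact ⟨j, hij, by omega, h' ▸ h⟩
    · obtain ⟨x, h1, h2, h3⟩ := ih h'
      exact ⟨x, h1, by omega, h3⟩

/-- If any two colours are separated by a function that changes at most twice along the cyclic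
order, then the colouring is noncrossing. -/
lemma noncrossing_of_cuts {n : ℕ} {γ : Type*} (c : Fin n → γ)
    (H : ∀ g h, g ≠ h → ∃ (f : γ → ℚ) (a b : Fin n), f g ≠ f h ∧
      ∀ i, i ≠ a → i ≠ b → f (c i) = f (c (finRotate n i))) : Noncrossing c := by
  intro i j k l hij hjk hkl hik hjl
  by_contra hne
  obtain ⟨f, a, b, hf, hab⟩ := H _ _ hne
  let u : ℕ → ℚ := fun x => if h : x < n then f (c ⟨x, h⟩) else 0
  have hu : ∀ x : Fin n, u x = f (c x) := fun x => by simp [u]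
  have hchange : ∀ x, x + 1 < n → u x ≠ u (x + 1) → x = a ∨ x = b := by
    intro x hx hne
    by_contra! hx'
    apply hne
    have := hab ⟨x, by omega⟩ (fun h => hx'.1 (by rw [← h])) (fun h => hx'.2 (by rw [← h]))
    obtain ⟨m, rfl⟩ : ∃ m, n = m + 1 := ⟨n - 1, by omega⟩
    rw [finRotate_of_lt (by omega)] at this
    rw [← hu, ← hu] at this
    exact this
  -- An alternating pattern yields changes in three disjoint intervals, while only the two places a
  -- and b allow one.
  obtain ⟨x, hx1, hx2, hx3⟩ := exists_change u (i := i) (j := j) (by exact hij.le)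
    (by rwa [hu, hu])
  obtain ⟨y, hy1, hy2, hy3⟩ := exists_change u (i := j) (j := k) (by exact hjk.le)
    (by rw [hu, hu, ← hik]; exact hf.symm)
  obtain ⟨z, hz1, hz2, hz3⟩ := exists_change u (i := k) (j := l) (by exact hkl.le)
    (by rwa [hu, hu, ← hik, ← hjl])
  have hl := l.2
  have := hchange x (by omega) hx3
  have := hchange y (by omega) hy3
  have := hchange z (by omega) hz3
  omega

end Cuts

/-! ### Gates and cogates do not cross in a spanning tree order. -/

namespace PlanarGraph

variable (M : PlanarGraph)

/-- Without edges there are no faces, so Euler's formula would give two vertices with nothing to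
connect them. -/
lemma n_pos : 0 < M.n := by
  rw [Nat.pos_iff_ne_zero]
  intro h0
  have : IsEmpty (Fin M.n) := by rw [h0]; infer_instance
  have he := M.euler
  rw [Nat.card_of_isEmpty, h0] at he
  have : 1 < Fintype.card (Fin M.p ⊕ Fin M.q) := by simp; omega
  obtain ⟨u, v, huv⟩ := Fintype.exists_pair_of_one_lt_card this
  obtain ⟨w, ⟨e, _⟩ | ⟨e, _⟩⟩ := exists_rel_of_connected_fromRel M.connected huv
  · exact isEmptyElim e
  · exact isEmptyElim e

lemma cogate_surjective : Function.Surjective M.cogate := by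
  intro c
  obtain ⟨w, ⟨e, h, _⟩ | ⟨e, _, h⟩⟩ := exists_rel_of_connected_fromRel M.connected
    (u := Sum.inr c) (v := Sum.inl (M.gate ⟨0, M.n_pos⟩)) (by simp)
  · exact absurd h (by simp)
  · exact ⟨e, (Sum.inr_injective h).symm⟩

lemma gate_rotG (e : Fin M.n) : M.gate (M.rotG e) = M.gate e :=
  ((M.gate_eq_iff _ _).2 ⟨1, by simp⟩).symm

lemma cogate_rotC_inv (e : Fin M.n) : M.cogate (M.rotC⁻¹ e) = M.cogate e :=
  ((M.cogate_eq_iff _ _).2 ⟨-1, by simp⟩).symm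

lemma rotG_next (e : Fin M.n) : M.rotG (M.next e) = M.rotC⁻¹ e := by
  simp [next]

lemma gate_rotC_inv (e : Fin M.n) : M.gate (M.rotC⁻¹ e) = M.gate (M.next e) := by
  rw [← rotG_next, gate_rotG]

lemma next_pow_inv_succ (e : Fin M.n) (k : ℕ) :
    M.next (((M.next⁻¹) ^ (k + 1)) e) = ((M.next⁻¹) ^ k) e := by
  rw [pow_succ', Equiv.Perm.mul_apply]
  simp

lemma next_pow_pow_inv (e : Fin M.n) (m k : ℕ) :
    (M.next ^ m) (((M.next⁻¹) ^ (m + k)) e) = ((M.next⁻¹) ^ k) e := by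
  rw [pow_add, Equiv.Perm.mul_apply, inv_pow]
  simp

variable {M} {T : Finset (Fin M.n)}

lemma IsSpanningTree.connected (hT : M.IsSpanningTree T) {α : Type*} (f : Fin M.p → α)
    (hf : ∀ e ∈ T, f (M.gate e) = f (M.gate (M.next e))) (u v : Fin M.p) : f u = f v := by
  refine eq_of_reachable_fromRel f ?_ (hT.1.preconnected u v)
  rintro _ _ ⟨e, he, rfl, rfl⟩
  exact hf e he

lemma IsSpanningTree.connected_subtype (hT : M.IsSpanningTree T) (f : Fin M.p → ℚ)
    (hf : ∀ e : {e // e ∈ T}, f (M.gate e) = f (M.gate (M.next e))) (u v : Fin M.p) :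
    f u = f v :=
  hT.connected f (fun e he => hf ⟨e, he⟩) u v

lemma IsSpanningTree.card_subtype (hT : M.IsSpanningTree T) :
    Fintype.card (Fin M.p) = Fintype.card {e // e ∈ T} + 1 := by
  rw [Fintype.card_fin, Fintype.card_coe, hT.2]

/-- No face has all its region edges in a spanning tree. -/
lemma IsSpanningTree.exists_notMem_face (hT : M.IsSpanningTree T) (e : Fin M.n) :
    ∃ e', M.next.SameCycle e e' ∧ e' ∉ T := by
  classical
  by_contra! hface
  obtain ⟨f, hf⟩ := exists_cut_of_tree (fun e : {e // e ∈ T} => M.gate e)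
    (fun e => M.gate (M.next e)) hT.connected_subtype hT.card_subtype
    ⟨e, hface e (Equiv.Perm.SameCycle.refl _ _)⟩
  -- The increments of the cut function around the face sum to 1, because e alone contributes; they
  -- also telescope to 0.
  have h1 : ∑ x, (if M.next.SameCycle e x then f (M.gate (M.next x)) - f (M.gate x) else 0) =
      1 := by
    rw [sum_eq_single e]
    · rw [if_pos (Equiv.Perm.SameCycle.refl _ _)]
      simpa using hf ⟨e, hface e (Equiv.Perm.SameCycle.refl _ _)⟩
    · intro x _ hx
      split_ifs with hc
      · simpa [hx] using hf ⟨x, hface x hc⟩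
      · rfl
    · simp
  have h2 : ∑ x, (if M.next.SameCycle e x then f (M.gate (M.next x)) else 0) =
      ∑ x, (if M.next.SameCycle e x then f (M.gate x) else 0) := by
    rw [← Equiv.sum_comp M.next fun x => if M.next.SameCycle e x then f (M.gate x) else 0]
    simp only [Equiv.Perm.sameCycle_apply_right]
  have h3 : ∀ x, (if M.next.SameCycle e x then f (M.gate (M.next x)) - f (M.gate x) else 0) =
      (if M.next.SameCycle e x then f (M.gate (M.next x)) else 0) -
        (if M.next.SameCycle e x then f (M.gate x) else 0) := by
    intro x
    split_ifs <;> simp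
  simp only [h3, sum_sub_distrib, h2, sub_self] at h1
  exact zero_ne_one h1

/-- In a spanning tree order the gates do not cross. -/
theorem noncrossing_gate {o : Equiv.Perm (Fin M.n)} (ho : M.IsSpanningTreeOrder o) :
    Noncrossing fun i => M.gate (o i) := by
  obtain ⟨T, hT, hfol⟩ := ho
  refine noncrossing_of_cuts _ fun g h hgh => ?_
  obtain ⟨f, ⟨t, ht⟩, hsep, hf⟩ := exists_separating_cut_of_tree
    (fun e : {e // e ∈ T} => M.gate e) (fun e => M.gate (M.next e)) hT.connected_subtype
    hT.card_subtype hgh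
  have hf' : ∀ e ∈ T, e ≠ t → f (M.gate e) = f (M.gate (M.next e)) := fun e he hne =>
    hf ⟨e, he⟩ fun h => hne (congrArg Subtype.val h)
  -- The curve can pass the cut edge t forwards only after crossing t itself, and backwards only
  -- after crossing the first edge outside T that follows t around its face. `After` describes this
  -- second edge.
  let After : Fin M.n → Prop := fun e => e ∉ T ∧ ∃ j : ℕ, t = ((M.next⁻¹) ^ (j + 1)) e ∧
    ∀ m ≤ j, ((M.next) ^ m) t ∈ T
  have hAfter : ∀ e e', After e → After e' → e = e' := by
    have aux : ∀ e e' j j', e ∉ T → t = ((M.next⁻¹) ^ (j + 1)) e → t = ((M.next⁻¹) ^ (j' + 1)) e' →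
        (∀ m ≤ j', ((M.next) ^ m) t ∈ T) → ¬ j < j' := by
      intro e e' j j' he h1 h2 hT' hlt
      apply he
      have := hT' (j + 1) hlt
      rwa [h1, next_pow_pow_inv M e (j + 1) 0] at this
    rintro e e' ⟨he, j, hj, hjT⟩ ⟨he', j', hj', hjT'⟩
    have h1 := aux e e' j j' he hj hj' hjT'
    have h2 := aux e' e j' j he' hj' hj hjT
    obtain rfl : j = j' := by omega
    exact ((M.next⁻¹) ^ (j + 1)).injective (hj.symm.trans hj')
  have hchange : ∀ i, f (M.gate (o i)) ≠ f (M.gate (o (finRotate M.n i))) →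
      o i = t ∨ After (o i) := by
    intro i hi
    rcases hfol i with ⟨he, h'⟩ | ⟨he, k, hk, _, h'⟩
    · left
      by_contra hne
      apply hi
      rw [h', gate_rotC_inv, hf' _ he hne]
    · right
      by_contra hno
      apply hi
      rw [h', gate_rotG]
      -- A backward walk that does not pass t stays on one side of the cut.
      have hclaim : ∀ m ≤ k, f (M.gate (o i)) = f (M.gate (((M.next⁻¹) ^ m) (o i))) := by
        intro m hm
        induction m with
        | zero => rfl
        | succ m ih =>
          rw [ih (by omega), ← next_pow_inv_succ M (o i) m, ← hf' _ (hk m (by omega))]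
          intro htm
          refine hno ⟨he, m, htm.symm, fun l hl => ?_⟩
          rw [← htm, show m + 1 = l + (m - l + 1) by omega, next_pow_pow_inv]
          exact hk _ (by omega)
      exact hclaim k le_rfl
  by_cases hex : ∃ e, After e
  · obtain ⟨e, he⟩ := hex
    refine ⟨f, o.symm t, o.symm e, hsep, fun i hia hib => ?_⟩
    by_contra hne
    rcases hchange i hne with h | h
    · exact hia (by rw [← h, Equiv.symm_apply_apply])
    · exact hib (by rw [hAfter e _ he h, Equiv.symm_apply_apply])
  · refine ⟨f, o.symm t, o.symm t, hsep, fun i hia _ => ?_⟩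
    by_contra hne
    rcases hchange i hne with h | h
    · exact hia (by rw [← h, Equiv.symm_apply_apply])
    · exact hex ⟨_, h⟩

/-- One step of the closed curve, seen from the cogates: it either stays at a cogate or passes
through a face from one edge outside the tree to another one. -/
lemma Follows.cogate_step {e e' : Fin M.n} (h : M.Follows T e e') :
    M.cogate e' = M.cogate e ∨
      e ∉ T ∧ ∃ d, d ∉ T ∧ M.next.SameCycle e d ∧ e' = M.rotC⁻¹ d := by
  rcases h with ⟨_, rfl⟩ | ⟨he, k, _, hk, rfl⟩
  · exact Or.inl (M.cogate_rotC_inv e)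
  · refine Or.inr ⟨he, _, hk, ⟨-((k : ℤ) + 1), ?_⟩, ?_⟩
    · rw [zpow_neg, inv_pow]
      norm_cast
    · rw [← rotG_next, next_pow_inv_succ]

/-- In a spanning tree order the cogates do not cross. -/
theorem noncrossing_cogate {o : Equiv.Perm (Fin M.n)} (ho : M.IsSpanningTreeOrder o) :
    Noncrossing fun i => M.cogate (o i) := by
  classical
  obtain ⟨T, hT, hfol⟩ := ho
  let Face := Quotient (Equiv.Perm.SameCycle.setoid M.next)
  let _ : Fintype Face := Fintype.ofFinite _
  -- The dual tree on cogates and faces; Euler's formula and |T| = p - 1 give it the right number of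
  -- edges.
  let s : {e // e ∉ T} → Fin M.q ⊕ Face := fun e => Sum.inl (M.cogate e)
  let t : {e // e ∉ T} → Fin M.q ⊕ Face := fun e => Sum.inr ⟦e.1⟧
  have hface : ∀ {e d : Fin M.n}, M.next.SameCycle e d → (⟦e⟧ : Face) = ⟦d⟧ := fun h =>
    Quotient.sound h
  have hcard : Fintype.card (Fin M.q ⊕ Face) = Fintype.card {e // e ∉ T} + 1 := by
    have he := M.euler
    have hT2 := hT.2
    rw [Fintype.card_sum, Fintype.card_fin, ← Nat.card_eq_fintype_card (α := Face),
      Fintype.card_subtype_compl, Fintype.card_fin, Fintype.card_coe]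
    have : T.card ≤ M.n := by simpa using card_le_univ T
    have : Nat.card Face =
      Nat.card (Quotient (Equiv.Perm.SameCycle.setoid (M.rotG⁻¹ * M.rotC⁻¹))) := rfl
    omega
  -- The curve crosses all edges and so visits all cogates, moving between them only through edges
  -- of the dual graph. Every face is attached, since it has an edge outside T.
  have hconn : ∀ f : Fin M.q ⊕ Face → ℚ, (∀ e, f (s e) = f (t e)) → ∀ u v, f u = f v := by
    intro f hf
    have hstep : ∀ i, f (Sum.inl (M.cogate (o (finRotate M.n i)))) =
        f (Sum.inl (M.cogate (o i))) := by
      intro i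
      rcases (hfol i).cogate_step with h | ⟨he, d, hd, hc, h⟩
      · rw [h]
      · rw [h, cogate_rotC_inv]
        have h1 := hf ⟨_, he⟩
        have h2 := hf ⟨d, hd⟩
        simp only [s, t] at h1 h2
        rw [h1, h2, hface hc]
    have hconst : ∀ i : Fin M.n, f (Sum.inl (M.cogate (o i))) =
        f (Sum.inl (M.cogate (o ⟨0, M.n_pos⟩))) := by
      rintro ⟨i, hi⟩
      induction i with
      | zero => rfl
      | succ i ih =>
        rw [← ih (by omega), ← hstep ⟨i, by omega⟩]
        congr 4
        obtain ⟨m, hm⟩ : ∃ m, M.n = m + 1 := ⟨M.n - 1, by omega⟩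
        have key : ∀ (n : ℕ) (h : n = m + 1) (h1 : i + 1 < n) (h2 : i < n),
            (⟨i + 1, h1⟩ : Fin n) = finRotate n ⟨i, h2⟩ := by
          rintro n rfl h1 h2
          rw [finRotate_of_lt (by omega)]
        exact key _ hm _ _
    have hall : ∀ u, f u = f (Sum.inl (M.cogate (o ⟨0, M.n_pos⟩))) := by
      rintro (c | Q)
      · obtain ⟨e, rfl⟩ := M.cogate_surjective c
        rw [← hconst (o.symm e), Equiv.apply_symm_apply]
      · obtain ⟨e, rfl⟩ := Quotient.exists_rep Q
        obtain ⟨d, hd, hdT⟩ := hT.exists_notMem_face e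
        have h := hf ⟨d, hdT⟩
        simp only [s, t] at h
        change f (Sum.inr (⟦e⟧ : Face)) = _
        rw [hface hd, ← h, ← hconst (o.symm d), Equiv.apply_symm_apply]
    exact fun u v => (hall u).trans (hall v).symm
  refine noncrossing_of_cuts _ fun g h hgh => ?_
  obtain ⟨f, ⟨u, hu⟩, hsep, hf⟩ := exists_separating_cut_of_tree s t hconn hcard
    (g := Sum.inl g) (h := Sum.inl h) (by simpa using hgh)
  have hf' : ∀ e, e ∉ T → e ≠ u → f (Sum.inl (M.cogate e)) = f (Sum.inr (⟦e⟧ : Face)) :=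
    fun e he hne => hf ⟨e, he⟩ fun h => hne (congrArg Subtype.val h)
  -- The curve uses the dual edge u from cogate to face directly after crossing u, and from face to
  -- cogate directly before crossing `rotC⁻¹ u`.
  refine ⟨fun c => f (Sum.inl c), o.symm u, (finRotate M.n).symm (o.symm (M.rotC⁻¹ u)), hsep,
    fun i hia hib => ?_⟩
  rcases (hfol i).cogate_step with h | ⟨he, d, hd, hc, h⟩
  · simp only [h]
  · simp only
    have h1 : o i ≠ u := fun h => hia (by rw [← h, Equiv.symm_apply_apply])
    have h2 : d ≠ u := by
      rintro rfl
      exact hib (by rw [← h, Equiv.symm_apply_apply, Equiv.symm_apply_apply])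
    rw [h, cogate_rotC_inv, hf' _ he h1, hf' _ hd h2, hface hc]

end PlanarGraph

/-- The value of a closed Pfaffian circuit, in a spanning tree order. -/
theorem PfaffianData.Represents.value_eq_pf {F : Type*} [Field F] {M : PlanarGraph}
    {o : Equiv.Perm (Fin M.n)} (ho : M.IsSpanningTreeOrder o) {D : PfaffianData F M o}
    {C : Circuit F M} (h : D.Represents C) : C.value = D.γ * pf D.Ω :=
  h.value_eq (PlanarGraph.noncrossing_gate ho) (PlanarGraph.noncrossing_cogate ho)

/-! ### Reasoning about machine programs and their running times. -/

section Store

variable {F : Type*}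

lemma Store.setI_int (s : Store F) (a i v a' i' : ℕ) :
    (s.setI a i v).int a' i' = if a' = a ∧ i' = i then v else s.int a' i' := by
  by_cases ha : a' = a
  · subst ha
    simp [Store.setI, Function.update_apply]
  · simp [Store.setI, ha]

lemma Store.setF_fld (s : Store F) (a i j : ℕ) (v : F) (a' i' j' : ℕ) :
    (s.setF a i j v).fld a' i' j' = if a' = a ∧ i' = i ∧ j' = j then v else s.fld a' i' j' := by
  by_cases ha : a' = a
  · subst ha
    by_cases hi : i' = i
    · subst hi
      simp [Store.setF, Function.update_apply]
    · simp [Store.setF, hi]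
  · simp [Store.setF, ha]

end Store

section ProgramLogic

variable {F : Type*} [Field F]

/-- `P` takes `s` to `s'` in at most `N` steps. -/
def Runs (inp : Store F) (P : Prog F) (s s' : Store F) (N : ℕ) : Prop :=
  ∃ t ≤ N, Exec inp P s s' t

variable {inp : Store F} {P Q : Prog F} {b : Test F} {s s₁ s₂ s' : Store F} {N N₁ N₂ : ℕ}

lemma Runs.mono (h : Runs inp P s s' N₁) (hN : N₁ ≤ N₂) : Runs inp P s s' N₂ :=
  let ⟨t, ht, he⟩ := h
  ⟨t, ht.trans hN, he⟩

lemma Runs.seq (h₁ : Runs inp P s s₁ N₁) (h₂ : Runs inp Q s₁ s₂ N₂) :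
    Runs inp (.seq P Q) s s₂ (N₁ + N₂) :=
  let ⟨_, ht, he⟩ := h₁
  let ⟨_, hu, hf⟩ := h₂
  ⟨_, add_le_add ht hu, he.seq hf⟩

lemma runs_setI (a : ℕ) (i v : IExp) : Runs inp (.setI a i v) s
    (s.setI a (i.eval inp s) (v.eval inp s)) (i.cost + v.cost + 1) :=
  ⟨_, le_rfl, .setI _ _ _ _⟩

lemma runs_setI_of_eval (a : ℕ) {i v : IExp} {j w : ℕ} (hi : i.eval inp s = j)
    (hv : v.eval inp s = w) (hN : i.cost + v.cost + 1 ≤ N) :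
    Runs inp (.setI a i v) s (s.setI a j w) N := by
  subst hi hv
  exact (runs_setI a i v).mono hN

lemma runs_setF (a : ℕ) (i j : IExp) (v : FExp F) : Runs inp (.setF a i j v) s
    (s.setF a (i.eval inp s) (j.eval inp s) (v.eval inp s)) (i.cost + j.cost + v.cost + 1) :=
  ⟨_, le_rfl, .setF _ _ _ _ _⟩

lemma runs_skip : Runs inp .skip s s 1 := ⟨_, le_rfl, .skip _⟩

lemma Runs.iteTrue (hb : b.Holds inp s) (h : Runs inp P s s' N) :
    Runs inp (.ite b P Q) s s' (b.cost + N) :=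
  let ⟨_, ht, he⟩ := h
  ⟨_, add_le_add le_rfl ht, .iteTrue hb he⟩

lemma Runs.iteFalse (hb : ¬b.Holds inp s) (h : Runs inp Q s s' N) :
    Runs inp (.ite b P Q) s s' (b.cost + N) :=
  let ⟨_, ht, he⟩ := h
  ⟨_, add_le_add le_rfl ht, .iteFalse hb he⟩

lemma Runs.whileTrue (hb : b.Holds inp s) (h : Runs inp P s s₁ N₁)
    (h' : Runs inp (.while b P) s₁ s₂ N₂) : Runs inp (.while b P) s s₂ (b.cost + N₁ + N₂) :=
  let ⟨_, ht, he⟩ := h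
  let ⟨_, hu, hf⟩ := h'
  ⟨_, add_le_add (add_le_add le_rfl ht) hu, .whileTrue hb he hf⟩

lemma runs_whileFalse (hb : ¬b.Holds inp s) : Runs inp (.while b P) s s b.cost :=
  ⟨_, le_rfl, .whileFalse hb⟩

/-- Repeat `P` as often as the entry `d` of the first input array says, with the counter in the
first entry of the array `c`. -/
def Prog.forLoop (c d : ℕ) (P : Prog F) : Prog F :=
  .seq (.setI c (.const 0) (.const 0)) <|
    .while (.lt (.get c (.const 0)) (.inp 0 (.const d))) <|
      .seq P (.setI c (.const 0) (.add (.get c (.const 0)) (.const 1)))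

/-- A round costs 5 for the test and 6 for the increment besides the body; the start costs 3 and the
failing test 5. `hset` makes the invariant insensitive to the counter. -/
lemma runs_forLoop {c d n B : ℕ} (hn : inp.int 0 d = n) (J : ℕ → Store F → Prop)
    (hset : ∀ k s v, J k s → J k (s.setI c 0 v))
    (hbody : ∀ k < n, ∀ s, J k s → s.int c 0 = k →
      ∃ s', Runs inp P s s' B ∧ J (k + 1) s' ∧ s'.int c 0 = k) (h0 : J 0 s) :
    ∃ s', Runs inp (Prog.forLoop c d P) s s' (n * (B + 11) + 8) ∧ J n s' := by
  have hloop : ∀ m k, k + m = n → ∀ s, J k s → s.int c 0 = k →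
      ∃ s', Runs inp (.while (.lt (.get c (.const 0)) (.inp 0 (.const d)))
        (.seq P (.setI c (.const 0) (.add (.get c (.const 0)) (.const 1))))) s s'
          (m * (B + 11) + 5) ∧ J n s' := by
    intro m
    induction m with
    | zero =>
      intro k hk s hJ hc
      rw [add_zero] at hk
      subst hk
      refine ⟨s, (runs_whileFalse ?_).mono (by simp [Test.cost, IExp.cost]), hJ⟩
      simp [Test.Holds, IExp.eval, hc, hn]
    | succ m ih =>
      intro k hk s hJ hc
      obtain ⟨s₁, hr, hJ₁, hc₁⟩ := hbody k (by omega) s hJ hc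
      obtain ⟨s₂, hr₂, hJ₂⟩ := ih (k + 1) (by omega) (s₁.setI c 0 (k + 1)) (hset _ _ _ hJ₁)
        (by simp [Store.setI_int])
      refine ⟨s₂, (Runs.whileTrue ?_ (hr.seq (s₂ := s₁.setI c 0 (k + 1)) ?_) hr₂).mono
        (N₁ := 5 + (B + 6) + (m * (B + 11) + 5)) ?_, hJ₂⟩
      · simp only [Test.Holds, IExp.eval, hc, hn]
        omega
      · have := runs_setI (inp := inp) (s := s₁) c (.const 0) (.add (.get c (.const 0)) (.const 1))
        simpa [IExp.eval, IExp.cost, hc₁] using this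
      · rw [Nat.succ_mul]
        omega
  obtain ⟨s', hr, hJ⟩ := hloop n 0 (zero_add n) (s.setI c 0 0) (hset _ _ _ h0)
    (by simp [Store.setI_int])
  refine ⟨s', (Runs.seq (s₁ := s.setI c 0 0) (N₁ := 3) ?_ hr).mono (by omega), hJ⟩
  exact runs_setI (inp := inp) (s := s) c (.const 0) (.const 0)

end ProgramLogic

/-! ### Simulation of a program for Ω on the inputs Ξ and Θ. -/

section Translation

variable {F : Type*} [Field F]

/-- A bound for the names of the arrays in working memory. -/
def IExp.names : IExp → ℕ
  | const _ => 0
  | inp _ i => i.names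
  | get a i => max (a + 1) i.names
  | add x y => max x.names y.names
  | sub x y => max x.names y.names

def FExp.names : FExp F → ℕ
  | const _ => 0
  | inp _ i j => max i.names j.names
  | get a i j => max (a + 1) (max i.names j.names)
  | add x y => max x.names y.names
  | sub x y => max x.names y.names
  | mul x y => max x.names y.names
  | inv x => x.names

def Test.names : Test F → ℕ
  | lt x y => max x.names y.names
  | eq x y => max x.names y.names
  | feq x y => max x.names y.names

def Prog.names : Prog F → ℕ
  | skip => 0
  | setI a i v => max (a + 1) (max i.names v.names)
  | setF a i j v => max (a + 1) (max i.names (max j.names v.names))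
  | seq P Q => max P.names Q.names
  | ite b P Q => max b.names (max P.names Q.names)
  | .while b P => max b.names P.names

/-- Replace the entries of the input matrix `Ω` by expressions in the entries of `Ξ` and `Θ`, when
the signs `(-1)^i` are stored in the array `N`. -/
def FExp.withBlocks (N : ℕ) : FExp F → FExp F
  | const c => const c
  | inp 0 i j => sub (inp 0 i j)
      (mul (mul (get N i (.const 0)) (get N j (.const 0))) (inp 1 i j))
  | inp (_ + 1) _ _ => const 0
  | get a i j => get a i j
  | add x y => add (x.withBlocks N) (y.withBlocks N)
  | sub x y => sub (x.withBlocks N) (y.withBlocks N)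
  | mul x y => mul (x.withBlocks N) (y.withBlocks N)
  | inv x => inv (x.withBlocks N)

def Test.withBlocks (N : ℕ) : Test F → Test F
  | lt x y => lt x y
  | eq x y => eq x y
  | feq x y => feq (x.withBlocks N) (y.withBlocks N)

def Prog.withBlocks (N : ℕ) : Prog F → Prog F
  | skip => skip
  | setI a i v => setI a i v
  | setF a i j v => setF a i j (v.withBlocks N)
  | seq P Q => seq (P.withBlocks N) (Q.withBlocks N)
  | ite b P Q => ite (b.withBlocks N) (P.withBlocks N) (Q.withBlocks N)
  | .while b P => .while (b.withBlocks N) (P.withBlocks N)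

/-- The factor comes from a read of the matrix: each index expression is evaluated three times, with
nine steps on top. -/
lemma FExp.cost_withBlocks_le (N : ℕ) (x : FExp F) : (x.withBlocks N).cost ≤ 9 * x.cost := by
  induction x with
  | const c => simp [withBlocks, cost]
  | inp a i j =>
    cases a <;> simp only [withBlocks, cost, IExp.cost] <;> omega
  | get a i j => simp only [withBlocks, cost]; omega
  | add x y hx hy => simp only [withBlocks, cost]; omega
  | sub x y hx hy => simp only [withBlocks, cost]; omega
  | mul x y hx hy => simp only [withBlocks, cost]; omega
  | inv x hx => simp only [withBlocks, cost]; omega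

lemma Test.cost_withBlocks_le (N : ℕ) (x : Test F) : (x.withBlocks N).cost ≤ 9 * x.cost := by
  cases x with
  | lt x y => simp only [withBlocks, cost]; omega
  | eq x y => simp only [withBlocks, cost]; omega
  | feq x y =>
    have hx := x.cost_withBlocks_le N
    have hy := y.cost_withBlocks_le N
    simp only [withBlocks, cost]
    omega

/-- The store `s'` of the translated program simulates the store `s`. -/
structure Simulates (N : ℕ) (inp inp' s s' : Store F) : Prop where
  inp_int : inp.int = inp'.int
  inp_fld_succ : ∀ a i j, inp.fld (a + 1) i j = 0
  int_eq : ∀ a < N, s.int a = s'.int a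
  fld_eq : ∀ a < N, s.fld a = s'.fld a
  signs : ∀ i j, inp.fld 0 i j =
    inp'.fld 0 i j - s'.fld N i 0 * s'.fld N j 0 * inp'.fld 1 i j

namespace Simulates

variable {N : ℕ} {inp inp' s s' : Store F}

lemma iexp_eval (h : Simulates N inp inp' s s') (x : IExp) (hx : x.names ≤ N) :
    x.eval inp' s' = x.eval inp s := by
  induction x with
  | const k => rfl
  | inp a i hi =>
    simp only [IExp.names] at hx
    simp only [IExp.eval, hi hx, h.inp_int]
  | get a i hi =>
    simp only [IExp.names, max_le_iff] at hx
    simp only [IExp.eval, hi hx.2, h.int_eq a hx.1]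
  | add x y ihx ihy =>
    simp only [IExp.names, max_le_iff] at hx
    simp only [IExp.eval, ihx hx.1, ihy hx.2]
  | sub x y ihx ihy =>
    simp only [IExp.names, max_le_iff] at hx
    simp only [IExp.eval, ihx hx.1, ihy hx.2]

lemma fexp_eval (h : Simulates N inp inp' s s') (x : FExp F) (hx : x.names ≤ N) :
    (x.withBlocks N).eval inp' s' = x.eval inp s := by
  induction x with
  | const k => rfl
  | inp a i j =>
    simp only [FExp.names, max_le_iff] at hx
    cases a with
    | zero =>
      simp only [FExp.withBlocks, FExp.eval, IExp.eval, h.iexp_eval i hx.1, h.iexp_eval j hx.2,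
        h.signs]
    | succ a => simp only [FExp.withBlocks, FExp.eval, h.inp_fld_succ]
  | get a i j =>
    simp only [FExp.names, max_le_iff] at hx
    simp only [FExp.withBlocks, FExp.eval, h.iexp_eval i hx.2.1, h.iexp_eval j hx.2.2,
      h.fld_eq a hx.1]
  | add x y ihx ihy =>
    simp only [FExp.names, max_le_iff] at hx
    simp only [FExp.withBlocks, FExp.eval, ihx hx.1, ihy hx.2]
  | sub x y ihx ihy =>
    simp only [FExp.names, max_le_iff] at hx
    simp only [FExp.withBlocks, FExp.eval, ihx hx.1, ihy hx.2]
  | mul x y ihx ihy =>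
    simp only [FExp.names, max_le_iff] at hx
    simp only [FExp.withBlocks, FExp.eval, ihx hx.1, ihy hx.2]
  | inv x ihx =>
    simp only [FExp.names] at hx
    simp only [FExp.withBlocks, FExp.eval, ihx hx]

lemma holds_iff (h : Simulates N inp inp' s s') (b : Test F) (hb : b.names ≤ N) :
    (b.withBlocks N).Holds inp' s' ↔ b.Holds inp s := by
  cases b <;> simp only [Test.names, max_le_iff] at hb <;>
    simp only [Test.withBlocks, Test.Holds]
  · rw [h.iexp_eval _ hb.1, h.iexp_eval _ hb.2]
  · rw [h.iexp_eval _ hb.1, h.iexp_eval _ hb.2]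
  · rw [h.fexp_eval _ hb.1, h.fexp_eval _ hb.2]

lemma setI (h : Simulates N inp inp' s s') {a : ℕ} (i v : ℕ) :
    Simulates N inp inp' (s.setI a i v) (s'.setI a i v) := by
  refine ⟨h.inp_int, h.inp_fld_succ, fun a' ha' => ?_, h.fld_eq, h.signs⟩
  funext i'
  rw [Store.setI_int, Store.setI_int, h.int_eq a' ha']

/-- The bound on the name protects the sign array N; integer arrays need no such bound. -/
lemma setF (h : Simulates N inp inp' s s') {a : ℕ} (ha : a < N) (i j : ℕ) (v : F) :
    Simulates N inp inp' (s.setF a i j v) (s'.setF a i j v) := by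
  refine ⟨h.inp_int, h.inp_fld_succ, h.int_eq, fun a' ha' => ?_, ?_⟩
  · funext i' j'
    rw [Store.setF_fld, Store.setF_fld, h.fld_eq a' ha']
  · simpa only [Store.setF_fld, ha.ne', false_and, if_false] using h.signs

end Simulates

/-- A translated program simulates the original one with a constant slow down. -/
lemma Exec.withBlocks {N : ℕ} {inp inp' s s₁ : Store F} {P : Prog F} {t : ℕ}
    (he : Exec inp P s s₁ t) (hP : P.names ≤ N) {s' : Store F} (h : Simulates N inp inp' s s') :
    ∃ s₁', Runs inp' (P.withBlocks N) s' s₁' (9 * t) ∧ Simulates N inp inp' s₁ s₁' := by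
  induction he generalizing s' with
  | skip s => exact ⟨s', runs_skip.mono (by omega), h⟩
  | setI s a i v =>
    simp only [Prog.names, max_le_iff] at hP
    have hr := runs_setI (inp := inp') (s := s') a i v
    rw [h.iexp_eval i hP.2.1, h.iexp_eval v hP.2.2] at hr
    exact ⟨_, hr.mono (by omega), h.setI _ _⟩
  | setF s a i j v =>
    simp only [Prog.names, max_le_iff] at hP
    have hr := runs_setF (inp := inp') (s := s') a i j (v.withBlocks N)
    rw [h.iexp_eval i hP.2.1, h.iexp_eval j hP.2.2.1, h.fexp_eval v hP.2.2.2] at hr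
    have := v.cost_withBlocks_le N
    exact ⟨_, hr.mono (by omega), h.setF hP.1 _ _ _⟩
  | seq _ _ ih₁ ih₂ =>
    simp only [Prog.names, max_le_iff] at hP
    obtain ⟨s₁', hr₁, h₁⟩ := ih₁ hP.1 h
    obtain ⟨s₂', hr₂, h₂⟩ := ih₂ hP.2 h₁
    exact ⟨s₂', (hr₁.seq hr₂).mono (by omega), h₂⟩
  | @iteTrue b _ _ _ _ _ hb _ ih =>
    simp only [Prog.names, max_le_iff] at hP
    obtain ⟨s₁', hr, h₁⟩ := ih hP.2.1 h
    have := b.cost_withBlocks_le N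
    exact ⟨s₁', (Runs.iteTrue ((h.holds_iff b hP.1).2 hb) hr).mono (by omega), h₁⟩
  | @iteFalse b _ _ _ _ _ hb _ ih =>
    simp only [Prog.names, max_le_iff] at hP
    obtain ⟨s₁', hr, h₁⟩ := ih hP.2.2 h
    have := b.cost_withBlocks_le N
    exact ⟨s₁', (Runs.iteFalse (mt (h.holds_iff b hP.1).1 hb) hr).mono (by omega), h₁⟩
  | @whileTrue b _ _ _ _ _ _ hb _ _ ih₁ ih₂ =>
    have hP' := hP
    simp only [Prog.names, max_le_iff] at hP'
    obtain ⟨s₁', hr₁, h₁⟩ := ih₁ hP'.2 h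
    obtain ⟨s₂', hr₂, h₂⟩ := ih₂ hP h₁
    have := b.cost_withBlocks_le N
    exact ⟨s₂', (Runs.whileTrue ((h.holds_iff b hP'.1).2 hb) hr₁ hr₂).mono (by omega), h₂⟩
  | @whileFalse b _ _ hb =>
    simp only [Prog.names, max_le_iff] at hP
    have := b.cost_withBlocks_le N
    exact ⟨s', (runs_whileFalse (mt (h.holds_iff b hP.1).1 hb)).mono (by omega), h⟩

end Translation

/-! ### Reduction of circuit values to planar Pfaffians. -/

section Reduction

variable {F : Type*} [Field F]

/-- Store the signs `(-1)^i` for all labels in the array `N`. -/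
def Prog.storeSigns (F : Type*) [Field F] (N : ℕ) : Prog F :=
  .seq (.setF N (.const 0) (.const 0) (.const 1)) <|
    .forLoop N 0 <| .setF N (.add (.get N (.const 0)) (.const 1)) (.const 0)
      (.sub (.const 0) (.get N (.get N (.const 0)) (.const 0)))

/-- Multiply the result by the first `inp 0 d` entries of the input array `a`. -/
def Prog.multiplyBy (F : Type*) [Field F] (N d a : ℕ) : Prog F :=
  .forLoop N d <| .setF 0 (.const 0) (.const 0)
    (.mul (.get 0 (.const 0) (.const 0)) (.inp a (.get N (.const 0)) (.const 0)))

/-- Besides the signs, it matters that all arrays below N are still zero, as the simulated program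
starts from empty memory. The counter is kept in the integer array N. -/
lemma runs_storeSigns {N n : ℕ} {inp : Store F} (hn : inp.int 0 0 = n) :
    ∃ s', Runs inp (Prog.storeSigns F N) (Store.zero F) s' (23 * n + 12) ∧
      (∀ a < N, s'.int a = fun _ => 0) ∧ (∀ a < N, s'.fld a = fun _ _ => 0) ∧
      ∀ i ≤ n, s'.fld N i 0 = (-1) ^ i := by
  let J : ℕ → Store F → Prop := fun k s => (∀ a < N, s.int a = fun _ => 0) ∧
    (∀ a < N, s.fld a = fun _ _ => 0) ∧ ∀ i ≤ k, s.fld N i 0 = (-1) ^ i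
  have h0 : J 0 ((Store.zero F).setF N 0 0 1) := by
    refine ⟨fun a _ => rfl, fun a ha => ?_, fun i hi => ?_⟩
    · funext i j
      rw [Store.setF_fld, if_neg (by omega)]
      rfl
    · obtain rfl : i = 0 := by omega
      simp [Store.setF_fld]
  have hset : ∀ k s v, J k s → J k (s.setI N 0 v) := by
    rintro k s v ⟨h1, h2, h3⟩
    refine ⟨fun a ha => ?_, h2, h3⟩
    funext i
    rw [Store.setI_int, if_neg (by omega), h1 a ha]
  have hbody : ∀ k < n, ∀ s, J k s → s.int N 0 = k →
      ∃ s', Runs inp (.setF N (.add (.get N (.const 0)) (.const 1)) (.const 0)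
        (.sub (.const 0) (.get N (.get N (.const 0)) (.const 0)))) s s' 12 ∧ J (k + 1) s' ∧
          s'.int N 0 = k := by
    rintro k hk s ⟨h1, h2, h3⟩ hc
    have hr := runs_setF (inp := inp) (s := s) N (.add (.get N (.const 0)) (.const 1)) (.const 0)
      (.sub (.const 0) (.get N (.get N (.const 0)) (.const 0)))
    simp only [IExp.eval, FExp.eval, hc, h3 k le_rfl] at hr
    refine ⟨_, hr.mono (by simp [IExp.cost, FExp.cost]), ⟨h1, fun a ha => ?_, fun i hi => ?_⟩, hc⟩
    · funext i j
      rw [Store.setF_fld, if_neg (by omega), h2 a ha]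
    · rw [Store.setF_fld]
      split_ifs with h
      · rw [h.2.1, pow_succ]
        ring
      · exact h3 i (by omega)
  obtain ⟨s', hr, hJ⟩ := runs_forLoop hn J hset hbody h0
  refine ⟨s', (Runs.seq (runs_setF N (.const 0) (.const 0) (.const 1)) hr).mono ?_, hJ⟩
  simp only [IExp.cost, FExp.cost]
  omega

lemma runs_multiplyBy {N d a n : ℕ} {inp s : Store F} (hn : inp.int 0 d = n) (f : Fin n → F)
    (ha : ∀ i, inp.fld a i 0 = arr f i) :
    ∃ s', Runs inp (Prog.multiplyBy F N d a) s s' (22 * n + 8) ∧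
      s'.fld 0 0 0 = s.fld 0 0 0 * ∏ i, f i := by
  let J : ℕ → Store F → Prop := fun k s' => s'.fld 0 0 0 = s.fld 0 0 0 * ∏ i ∈ range k, arr f i
  have hbody : ∀ k < n, ∀ s, J k s → s.int N 0 = k →
      ∃ s', Runs inp (.setF 0 (.const 0) (.const 0) (.mul (.get 0 (.const 0) (.const 0))
        (.inp a (.get N (.const 0)) (.const 0)))) s s' 11 ∧ J (k + 1) s' ∧ s'.int N 0 = k := by
    intro k hk s' hs' hc
    have hr := runs_setF (inp := inp) (s := s') 0 (.const 0) (.const 0)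
      (.mul (.get 0 (.const 0) (.const 0)) (.inp a (.get N (.const 0)) (.const 0)))
    simp only [IExp.eval, FExp.eval, hc] at hr
    refine ⟨_, hr.mono (by simp [IExp.cost, FExp.cost]), ?_, hc⟩
    simp only [J, Store.setF_fld, prod_range_succ, ha]
    rw [if_pos (by simp), hs', mul_assoc]
  obtain ⟨s', hr, hJ⟩ := runs_forLoop (s := s) hn J (fun k s v h => h) hbody (by simp [J])
  refine ⟨s', hr.mono (by omega), ?_⟩
  rw [hJ, prod_range]
  simp [arr]

variable {M : PlanarGraph} {o : Equiv.Perm (Fin M.n)} (D : PfaffianData F M o)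

/-- Outside the range of labels both matrix arrays vanish, so the signs stored there are irrelevant.
-/
lemma arr₂_add_checkerboard {n : ℕ} (A B : Matrix (Fin n) (Fin n) F) (σ : ℕ → F)
    (hσ : ∀ i ≤ n, σ i = (-1) ^ i) (i j : ℕ) :
    arr₂ (A + checkerboard B) i j = arr₂ A i j - σ i * σ j * arr₂ B i j := by
  unfold arr₂ arr
  split_ifs with hi hj
  · rw [hσ i hi.le, hσ j hj.le]
    simp only [Matrix.add_apply, checkerboard, pow_add, pow_one]
    ring
  · simp
  · simp

lemma PfaffianData.isSkew_Ω : IsSkew D.Ω := by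
  have hΞ : ∀ i j, D.sumΞ j i = -D.sumΞ i j := by
    intro i j
    simp only [PfaffianData.sumΞ]
    by_cases h : M.gate (o i) = M.gate (o j)
    · rw [dif_pos h, dif_pos h.symm]
      have key : ∀ g (hi : M.gate (o i) = g) (hj : M.gate (o j) = g),
          D.Ξ g ⟨j, hj⟩ ⟨i, hi⟩ = -D.Ξ g ⟨i, hi⟩ ⟨j, hj⟩ := fun g hi hj => (D.skewΞ g).2 _ _
      -- The entries (i, j) and (j, i) are taken from blocks indexed by equal but differently
      -- written gates.
      have cast : ∀ g (hi : M.gate (o i) = g) (hj : M.gate (o j) = g),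
          D.Ξ (M.gate (o i)) ⟨j, h.symm⟩ ⟨i, rfl⟩ = D.Ξ g ⟨j, hj⟩ ⟨i, hi⟩ := by
        rintro _ rfl _
        rfl
      rw [cast _ h rfl, key]
    · rw [dif_neg h, dif_neg (Ne.symm h), neg_zero]
  have hΘ : ∀ i j, D.sumΘ j i = -D.sumΘ i j := by
    intro i j
    simp only [PfaffianData.sumΘ]
    by_cases h : M.cogate (o i) = M.cogate (o j)
    · rw [dif_pos h, dif_pos h.symm]
      have key : ∀ g (hi : M.cogate (o i) = g) (hj : M.cogate (o j) = g),
          D.Θ g ⟨j, hj⟩ ⟨i, hi⟩ = -D.Θ g ⟨i, hi⟩ ⟨j, hj⟩ := fun g hi hj => (D.skewΘ g).2 _ _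
      have cast : ∀ g (hi : M.cogate (o i) = g) (hj : M.cogate (o j) = g),
          D.Θ (M.cogate (o i)) ⟨j, h.symm⟩ ⟨i, rfl⟩ = D.Θ g ⟨j, hj⟩ ⟨i, hi⟩ := by
        rintro _ rfl _
        rfl
      rw [cast _ h rfl, key]
    · rw [dif_neg h, dif_neg (Ne.symm h), neg_zero]
  refine ⟨fun i => ?_, fun i j => ?_⟩
  · simp [PfaffianData.Ω, checkerboard, PfaffianData.sumΞ, PfaffianData.sumΘ, (D.skewΞ _).1,
      (D.skewΘ _).1]
  · simp only [PfaffianData.Ω, Matrix.add_apply, checkerboard, hΞ i j, hΘ i j,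
      add_comm (j : ℕ) (i : ℕ)]
    ring

lemma PfaffianData.supportedOn_Ω : SupportedOn M o D.Ω := by
  intro i j hij
  by_contra! h
  apply hij
  simp [PfaffianData.Ω, checkerboard, PfaffianData.sumΞ, PfaffianData.sumΘ, h.1, h.2]

lemma PlanarGraph.card_vertices_le (M : PlanarGraph) : M.p + M.q ≤ M.n + 1 := by
  have he := M.euler
  have : 0 < Nat.card (Quotient (Equiv.Perm.SameCycle.setoid (M.rotG⁻¹ * M.rotC⁻¹))) :=
    Nat.card_pos_iff.2 ⟨⟨⟦⟨0, M.n_pos⟩⟧⟩, inferInstance⟩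
  omega

/-- Evaluating a Pfaffian circuit costs as much as one planar Pfaffian. -/
theorem CircuitValueInTime.of_planarPfaffian {K : Set PlanarGraph} {T : PlanarGraph → ℝ}
    (h : PlanarPfaffianInTime F K T) : CircuitValueInTime F K fun M => 100 * (T M + M.n) := by
  obtain ⟨P, hP⟩ := h
  -- The extra 1 keeps the result array 0 below N even if P names no array.
  let N := P.names + 1
  refine ⟨.seq (Prog.storeSigns F N) (.seq (P.withBlocks N)
    (.seq (Prog.multiplyBy F N 1 2) (Prog.multiplyBy F N 2 3))), fun M hM o ho C D hD => ?_⟩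
  obtain ⟨s, t, he, ht, hs⟩ := hP M hM o ho D.Ω D.isSkew_Ω D.supportedOn_Ω
  have hn : (circuitInput D).int 0 0 = M.n := rfl
  have hp : (circuitInput D).int 0 1 = M.p := rfl
  have hq : (circuitInput D).int 0 2 = M.q := rfl
  obtain ⟨s₁, hr₁, hi, hf, hsgn⟩ := runs_storeSigns (N := N) hn
  have hsim : Simulates N (pfaffianInput M o D.Ω) (circuitInput D) (Store.zero F) s₁ :=
    ⟨rfl, fun _ _ _ => rfl, fun a ha => (hi a ha).symm, fun a ha => (hf a ha).symm,
      arr₂_add_checkerboard _ _ _ hsgn⟩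
  obtain ⟨s₂, hr₂, hsim₂⟩ := he.withBlocks (Nat.le_succ _) hsim
  obtain ⟨s₃, hr₃, h₃⟩ := runs_multiplyBy (N := N) (s := s₂) hp D.α (a := 2) fun i => rfl
  obtain ⟨s₄, hr₄, h₄⟩ := runs_multiplyBy (N := N) (s := s₃) hq D.β (a := 3) fun i => rfl
  obtain ⟨u, hu, hex⟩ := hr₁.seq (hr₂.seq (hr₃.seq hr₄))
  refine ⟨s₄, u, hex, ?_, ?_⟩
  · have h1 := M.card_vertices_le
    have h2 := M.n_pos
    -- Signs and products take 23n + 12 + 22(p + q) + 16 steps, which is at most 45n + 50 because p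
    -- + q ≤ n + 1; finally n ≥ 1.
    have h3 : u ≤ 9 * t + 95 * M.n := by omega
    have h4 : (u : ℝ) ≤ 9 * t + 95 * M.n := by exact_mod_cast h3
    have h5 : (0 : ℝ) ≤ t := Nat.cast_nonneg t
    have h6 : (0 : ℝ) ≤ M.n := Nat.cast_nonneg _
    linarith
  · rw [h₄, h₃, ← hsim₂.fld_eq 0 (Nat.succ_pos _), hs, hD.value_eq_pf ho, PfaffianData.γ]
    ring

lemma CircuitValueInTime.mono {K : Set PlanarGraph} {T T' : PlanarGraph → ℝ}
    (h : CircuitValueInTime F K T) (hT : ∀ M, T M ≤ T' M) : CircuitValueInTime F K T' := by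
  obtain ⟨P, hP⟩ := h
  refine ⟨P, fun M hM o ho C D hD => ?_⟩
  obtain ⟨s, t, he, ht, hs⟩ := hP M hM o ho C D hD
  exact ⟨s, t, he, ht.trans (hT M), hs⟩

theorem CircuitValueInTime.of_planarPfaffian_rpow {K : Set PlanarGraph} {ω c : ℝ} (hω : 1 ≤ ω)
    (h : PlanarPfaffianInTime F K fun M => c * (M.n : ℝ) ^ ω) :
    CircuitValueInTime F K fun M => 100 * (c + 1) * (M.n : ℝ) ^ ω := by
  refine (CircuitValueInTime.of_planarPfaffian h).mono fun M => ?_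
  have h1 : (1 : ℝ) ≤ M.n := by exact_mod_cast M.n_pos
  have h2 : (M.n : ℝ) ≤ (M.n : ℝ) ^ ω := Real.self_le_rpow_of_one_le h1 hω
  linarith

end Reduction

/-! ### Growing a spanning tree together with its boundary curve. -/

namespace PlanarGraph

variable (M : PlanarGraph)

/-- The edge at which the search for a spanning tree starts. -/
def root : Fin M.n := ⟨0, M.n_pos⟩

/-- The tree `T` spans the gates `V`; one cycle of `φ` is the boundary curve of its thickening, and
all other cycles are the rotations around the gates outside `V`. -/
structure PartialTree (V : Finset (Fin M.p)) (T : Finset (Fin M.n)) (φ : Equiv.Perm (Fin M.n)) :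
    Prop where
  sameCycle_iff : ∀ e, M.gate e ∈ V ↔ φ.SameCycle M.root e
  eq_rotG : ∀ e, M.gate e ∉ V → φ e = M.rotG e
  follows : ∀ e, M.gate e ∈ V → M.Follows T e (φ e)
  gate_mem : ∀ e ∈ T, M.gate e ∈ V
  gate_next_mem : ∀ e ∈ T, M.gate (M.next e) ∈ V
  reachable : ∀ g ∈ V, (SimpleGraph.fromRel fun g h : Fin M.p =>
    ∃ e ∈ T, g = M.gate e ∧ h = M.gate (M.next e)).Reachable (M.gate M.root) g
  card : T.card + 1 = V.card

/-- Around a single thickened gate the boundary curve is the rotation at that gate. -/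
lemma partialTree_singleton : M.PartialTree {M.gate M.root} ∅ M.rotG where
  sameCycle_iff e := by
    rw [mem_singleton, M.gate_eq_iff]
    exact Equiv.Perm.sameCycle_comm
  eq_rotG _ _ := rfl
  follows e _ := Or.inr ⟨notMem_empty _, 0, by simp, notMem_empty _, by simp⟩
  gate_mem e h := absurd h (notMem_empty e)
  gate_next_mem e h := absurd h (notMem_empty e)
  reachable g h := by rw [mem_singleton.1 h]
  card := by simp

variable {M} {V : Finset (Fin M.p)} {T : Finset (Fin M.n)} {φ : Equiv.Perm (Fin M.n)}

namespace PartialTree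

lemma root_mem (h : M.PartialTree V T φ) : M.gate M.root ∈ V :=
  (h.sameCycle_iff _).2 (Equiv.Perm.SameCycle.refl _ _)

lemma gate_apply_mem (h : M.PartialTree V T φ) (e : Fin M.n) :
    M.gate (φ e) ∈ V ↔ M.gate e ∈ V := by
  rw [h.sameCycle_iff, h.sameCycle_iff, Equiv.Perm.sameCycle_apply_right]

/-- A region edge that leads out of `V` can be added to the tree. -/
lemma extend (h : M.PartialTree V T φ) {e : Fin M.n} (he : M.gate e ∈ V)
    (hn : M.gate (M.next e) ∉ V) :
    M.PartialTree (insert (M.gate (M.next e)) V) (insert e T)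
      (φ * Equiv.swap e (M.next e)) := by
  set b := M.next e with hb
  set φ' := φ * Equiv.swap e b with hφ'
  have heT : e ∉ T := fun h' => hn (h.gate_next_mem e h')
  have hbT : b ∉ T := fun h' => hn (h.gate_mem b h')
  have hφe : φ' e = M.rotG b := by
    rw [hφ', Equiv.Perm.mul_apply, Equiv.swap_apply_left, h.eq_rotG b hn]
  have hφb : φ' b = φ e := by
    rw [hφ', Equiv.Perm.mul_apply, Equiv.swap_apply_right]
  have hφx : ∀ x, x ≠ e → x ≠ b → φ' x = φ x := fun x hx hx' => by
    rw [hφ', Equiv.Perm.mul_apply, Equiv.swap_apply_of_ne_of_ne hx hx']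
  refine ⟨fun x => ?_, fun x hx => ?_, fun x hx => ?_, fun x hx => ?_, fun x hx => ?_,
    fun g hg => ?_, ?_⟩
  -- The transposition merges two cycles: the new curve follows the old one up to e, and the
  -- rotation at the new gate up to b. Conversely, by `hinv` it never leaves the enlarged set of
  -- gates.
  · have hinv : ∀ x, M.gate (φ' x) ∈ insert (M.gate b) V ↔ M.gate x ∈ insert (M.gate b) V := by
      intro x
      by_cases hxe : x = e
      · rw [hxe, hφe, M.gate_rotG]
        simp [he]
      by_cases hxb : x = b
      · rw [hxb, hφb]
        simp [(h.gate_apply_mem e).2 he]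
      rw [hφx x hxe hxb, mem_insert, mem_insert, h.gate_apply_mem]
      by_cases hx : M.gate x ∈ V
      · simp [hx]
      · rw [h.eq_rotG x hx, M.gate_rotG]
    have hV : ∀ k : ℕ, ∀ x, M.gate x ∈ V → (φ ^ k) x = e → φ'.SameCycle e x := by
      intro k
      induction k with
      | zero =>
        rintro x - rfl
        exact Equiv.Perm.SameCycle.refl _ _
      | succ k ih =>
        intro x hx hk
        by_cases hxe : x = e
        · rw [hxe]
        have hxb : x ≠ b := fun h' => hn (h' ▸ hx)
        rw [← Equiv.Perm.sameCycle_apply_right, hφx x hxe hxb]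
        refine ih _ ((h.gate_apply_mem x).2 hx) ?_
        rw [← Equiv.Perm.mul_apply, ← pow_succ, hk]
    have hV' : ∀ x, M.gate x ∈ V → φ'.SameCycle e x := by
      intro x hx
      have hc : φ.SameCycle x e :=
        ((h.sameCycle_iff x).1 hx).symm.trans ((h.sameCycle_iff e).1 he)
      obtain ⟨k, hk⟩ := hc.exists_nat_pow_eq
      exact hV k x hx hk
    have hebc : φ'.SameCycle e b := by
      rw [← Equiv.Perm.sameCycle_apply_right, hφb]
      exact hV' _ ((h.gate_apply_mem e).2 he)
    have hG : ∀ k : ℕ, ∀ x, M.gate x = M.gate b → (M.rotG ^ k) x = b → φ'.SameCycle e x := by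
      intro k
      induction k with
      | zero =>
        rintro x - rfl
        exact hebc
      | succ k ih =>
        intro x hx hk
        by_cases hxb : x = b
        · rwa [hxb]
        have hxV : M.gate x ∉ V := by rwa [hx]
        have hxe : x ≠ e := fun h' => hxV (h' ▸ he)
        rw [← Equiv.Perm.sameCycle_apply_right, hφx x hxe hxb, h.eq_rotG x hxV]
        refine ih _ (by rw [M.gate_rotG, hx]) ?_
        rw [← Equiv.Perm.mul_apply, ← pow_succ, hk]
    have hroot := hV' _ h.root_mem
    constructor
    · intro hx
      rcases mem_insert.1 hx with hx | hx
      · obtain ⟨k, hk⟩ := ((M.gate_eq_iff _ _).1 hx).exists_nat_pow_eq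
        exact hroot.symm.trans (hG k x hx hk)
      · exact hroot.symm.trans (hV' x hx)
    · intro hc
      obtain ⟨k, rfl⟩ := hc.exists_nat_pow_eq
      induction k with
      | zero => exact mem_insert_of_mem h.root_mem
      | succ k ih =>
        rw [pow_succ', Equiv.Perm.mul_apply, hinv]
        exact ih ⟨k, by rw [zpow_natCast]⟩
  · rw [mem_insert, not_or] at hx
    rw [hφx x (fun h' => hx.2 (h' ▸ he)) (fun h' => hx.1 (h' ▸ rfl)), h.eq_rotG x hx.2]
  · by_cases hxe : x = e
    · subst hxe
      exact Or.inl ⟨mem_insert_self _ _, by rw [hφe, hb, rotG_next]⟩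
    by_cases hxb : x = b
    · subst hxb
      have hbe : b ≠ e := hxe
      rw [hφb]
      rcases h.follows e he with ⟨h', _⟩ | ⟨_, k, hk, hkT, hk'⟩
      · exact absurd h' heT
      have hback : ∀ j, ((M.next⁻¹) ^ (j + 1)) b = ((M.next⁻¹) ^ j) e := by
        intro j
        rw [pow_succ, Equiv.Perm.mul_apply, hb]
        simp
      -- After b the backward scan meets the new tree edge e and then repeats the scan from e, so it
      -- is longer by one.
      refine Or.inr ⟨by simp [hbe, hbT], k + 1, fun j hj => ?_, ?_, ?_⟩
      · rw [hback]
        cases j with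
        | zero => exact mem_insert_self _ _
        | succ j => exact mem_insert_of_mem (hk j (by omega))
      · rw [hback, mem_insert, not_or]
        -- If the scan from e came back to e, then b would be e or an element of T.
        refine ⟨fun h' => ?_, hkT⟩
        have : b = ((M.next⁻¹) ^ k) e := by
          rw [← next_pow_inv_succ, h']
        cases k with
        | zero => exact hbe this
        | succ k => exact hbT (this ▸ hk k (by omega))
      · rw [hback, hk']
    · have hxV : M.gate x ∈ V ∨ M.gate x ∉ V ∧ M.gate x = M.gate b := by
        rcases mem_insert.1 hx with hx | hx
        · exact Or.inr ⟨by rwa [hx], hx⟩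
        · exact Or.inl hx
      -- At the new gate no old tree edge is present, so the scan is empty and the curve simply
      -- rotates.
      have hfol : M.Follows T x (φ x) := by
        rcases hxV with hx | ⟨hx, _⟩
        · exact h.follows x hx
        · refine Or.inr ⟨fun h' => hx (h.gate_mem x h'), 0, by simp, fun h' => hx ?_, ?_⟩
          · have := h.gate_next_mem _ h'
            rwa [next_pow_inv_succ, pow_zero] at this
          · simpa using h.eq_rotG x hx
      rw [hφx x hxe hxb]
      rcases hfol with ⟨h1, h2⟩ | ⟨h1, k, hk, hkT, hk'⟩
      · exact Or.inl ⟨mem_insert_of_mem h1, h2⟩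
      · refine Or.inr ⟨by simp [hxe, h1], k, fun j hj => mem_insert_of_mem (hk j hj), ?_, hk'⟩
        rw [mem_insert, not_or]
        refine ⟨fun h' => ?_, hkT⟩
        have : b = ((M.next⁻¹) ^ k) x := by
          rw [← next_pow_inv_succ, h']
        cases k with
        | zero => exact hxb this.symm
        | succ k => exact hbT (this ▸ hk k (by omega))
  · rcases mem_insert.1 hx with rfl | hx
    · exact mem_insert_of_mem he
    · exact mem_insert_of_mem (h.gate_mem x hx)
  · rcases mem_insert.1 hx with rfl | hx
    · exact mem_insert_self _ _
    · exact mem_insert_of_mem (h.gate_next_mem x hx)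
  · have hmono : ∀ g ∈ V, (SimpleGraph.fromRel fun g h : Fin M.p =>
        ∃ x ∈ insert e T, g = M.gate x ∧ h = M.gate (M.next x)).Reachable (M.gate M.root) g := by
      intro g hg
      refine (h.reachable g hg).mono ?_
      intro u v huv
      rw [SimpleGraph.fromRel_adj] at huv ⊢
      refine ⟨huv.1, huv.2.imp ?_ ?_⟩ <;>
      · rintro ⟨x, hx, h'⟩
        exact ⟨x, mem_insert_of_mem hx, h'⟩
    rcases mem_insert.1 hg with rfl | hg
    · refine (hmono _ he).trans (SimpleGraph.Adj.reachable ?_)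
      rw [SimpleGraph.fromRel_adj]
      exact ⟨fun h' => hn (h' ▸ he), Or.inl ⟨e, mem_insert_self _ _, rfl, rfl⟩⟩
    · exact hmono g hg
  · rw [card_insert_of_notMem heT, card_insert_of_notMem hn, h.card]

lemma exists_pow_eq (h : M.PartialTree V T φ) {e : Fin M.n} (he : M.gate e ∈ V) :
    ∃ j < M.n, (φ ^ j) M.root = e := by
  classical
  let S : Finset (Fin M.n) := univ.filter fun x => φ.SameCycle M.root x
  have hS : φ.IsCycleOn (S : Set (Fin M.n)) := by
    refine ⟨φ.bijOn fun x => ?_, fun x hx y hy => ?_⟩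
    · simp [S, Equiv.Perm.sameCycle_apply_right]
    · simp only [S, coe_filter, mem_univ, true_and, Set.mem_ofPred_eq] at hx hy
      exact hx.symm.trans hy
  obtain ⟨j, hj, hje⟩ := hS.exists_pow_eq (a := M.root) (b := e)
    (by simp [S, Equiv.Perm.SameCycle.refl]) (by simpa [S] using (h.sameCycle_iff e).1 he)
  have : S.card ≤ M.n := by simpa using card_le_univ S
  exact ⟨j, by omega, hje⟩

/-- A set of gates that no region edge leaves contains all gates. -/
lemma eq_univ (h : M.PartialTree V T φ)
    (hclosed : ∀ e, M.gate e ∈ V → M.gate (M.next e) ∈ V) : V = univ := by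
  classical
  let B : Finset (Fin M.n) := univ.filter fun e => M.gate e ∈ V
  have hB : ∀ e, e ∈ B ↔ M.gate e ∈ V := fun e => by simp [B]
  -- An injection of a finite set into itself is onto, so `next` does not enter V from outside
  -- either.
  have himage : B.map M.next.toEmbedding = B := by
    refine eq_of_subset_of_card_le (fun e he => ?_) (by rw [card_map])
    obtain ⟨x, hx, rfl⟩ := mem_map.1 he
    exact (hB _).2 (hclosed x ((hB _).1 hx))
  have hnext : ∀ e, M.gate (M.next e) ∈ V ↔ M.gate e ∈ V := by
    refine fun e => ⟨fun he => ?_, hclosed e⟩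
    rw [← hB, ← himage] at he
    obtain ⟨x, hx, hxe⟩ := mem_map.1 he
    rw [← hB, ← M.next.injective hxe]
    exact hx
  -- Since `rotC⁻¹ e` and `next e` share their gate, the edges at one cogate have their gates all in
  -- V or all outside it.
  have hrotC : ∀ e, M.gate (M.rotC e) ∈ V ↔ M.gate e ∈ V := by
    intro e
    rw [← hnext (M.rotC e), ← gate_rotC_inv]
    simp
  have hpow : ∀ k : ℕ, ∀ e, M.gate ((M.rotC ^ k) e) ∈ V ↔ M.gate e ∈ V := by
    intro k
    induction k with
    | zero => simp
    | succ k ih =>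
      intro e
      rw [pow_succ', Equiv.Perm.mul_apply, hrotC, ih]
  have hcogate : ∀ e f, M.cogate e = M.cogate f → M.gate e ∈ V → M.gate f ∈ V := by
    intro e f hef he
    obtain ⟨k, rfl⟩ := ((M.cogate_eq_iff e f).1 hef).exists_nat_pow_eq
    exact (hpow k e).2 he
  let P : Fin M.p ⊕ Fin M.q → Prop := Sum.elim (· ∈ V)
    fun c => ∃ e, M.cogate e = c ∧ M.gate e ∈ V
  ext g
  have := eq_of_reachable_fromRel (u := Sum.inl (M.gate M.root)) (v := Sum.inl g) P ?_
    (M.connected.preconnected _ _)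
  · simp only [P, Sum.elim_inl, eq_iff_iff] at this
    simpa using this.1 h.root_mem
  · rintro _ _ ⟨e, rfl, rfl⟩
    simp only [P, Sum.elim_inl, Sum.elim_inr, eq_iff_iff]
    exact ⟨fun he => ⟨e, rfl, he⟩, fun ⟨f, hf, hfV⟩ => hcogate f e hf hfV⟩

/-- The boundary curve of a tree that spans all gates lists the edges in spanning tree order. -/
lemma exists_order (h : M.PartialTree univ T φ) :
    ∃ o, M.IsSpanningTreeOrder o ∧ ∀ i : Fin M.n, o i = (φ ^ (i : ℕ)) M.root := by
  let f : Fin M.n → Fin M.n := fun i => (φ ^ (i : ℕ)) M.root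
  have hsurj : Function.Surjective f := fun e =>
    let ⟨j, hj, hje⟩ := h.exists_pow_eq (mem_univ (M.gate e))
    ⟨⟨j, hj⟩, hje⟩
  have hbij : Function.Bijective f := Finite.surjective_iff_bijective.1 hsurj
  refine ⟨Equiv.ofBijective f hbij, ⟨T, ⟨?_, ?_⟩, fun i => ?_⟩, fun i => rfl⟩
  · have : Nonempty (Fin M.p) := ⟨M.gate M.root⟩
    exact ⟨fun u v => (h.reachable u (mem_univ u)).symm.trans (h.reachable v (mem_univ v))⟩
  · simpa using h.card
  · have hstep : f (finRotate M.n i) = φ (f i) := by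
      obtain ⟨j, hj⟩ := hsurj (φ (f i))
      have hpow : ∀ k : ℕ, φ ((φ ^ k) M.root) = (φ ^ (k + 1)) M.root := fun k => by
        rw [pow_succ', Equiv.Perm.mul_apply]
      have hi := i.2
      have hrot : (finRotate M.n i).val = if (i : ℕ) + 1 = M.n then 0 else (i : ℕ) + 1 := by
        have key : ∀ (n : ℕ) (i : Fin n),
            (finRotate n i).val = if (i : ℕ) + 1 = n then 0 else (i : ℕ) + 1 := by
          rintro (_ | n) i
          · exact i.elim0
          · rw [coe_finRotate]
            have : i = Fin.last n ↔ (i : ℕ) + 1 = n + 1 := by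
              rw [Fin.ext_iff, Fin.val_last]
              omega
            simp only [this]
        exact key _ i
      -- The successor of the last edge is again in the list; at a positive place it would have two
      -- preimages under φ, so it is the root.
      by_cases hlast : (i : ℕ) + 1 = M.n
      · rw [← hj]
        congr 1
        ext
        rw [hrot, if_pos hlast]
        by_contra hj0
        obtain ⟨m, hm⟩ : ∃ m, (j : ℕ) = m + 1 := ⟨j - 1, by omega⟩
        have h1 : φ ((φ ^ m) M.root) = φ (f i) := by rw [hpow, ← hm, ← hj]
        have h2 := hbij.1 (a₁ := ⟨m, by omega⟩) (a₂ := i) (φ.injective h1)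
        have h3 : m = i := congrArg Fin.val h2
        omega
      · simp only [f]
        rw [hrot, if_neg hlast, hpow]
    simp only [Equiv.ofBijective_apply, hstep]
    exact h.follows _ (mem_univ _)

end PartialTree

end PlanarGraph

/-! ### The linear-time search program and its invariant. -/

section Search

variable {F : Type*} [Field F]

/-- The body of the search loop. The arrays are: `0` the order, `1` the successors of the edges,
`2` the marks of the visited gates, `3` the current edge, `4` the loop counter. -/
def Prog.searchStep (F : Type*) : Prog F :=
  let cur := IExp.get 3 (.const 0)
  let back := IExp.inp 4 cur
  .seq (.setI 0 (.get 4 (.const 0)) cur) <|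
    .seq (.ite (.eq (.get 2 (.inp 5 back)) (.const 0))
      (.seq (.setI 2 (.inp 5 back) (.const 1))
        (.seq (.setI 1 (.inp 2 back) (.get 1 cur)) (.setI 1 cur back))) .skip) <|
      .setI 3 (.const 0) (.get 1 cur)

/-- The program that computes a spanning tree order. -/
def Prog.search (F : Type*) : Prog F :=
  .seq (.forLoop 4 0 (.setI 1 (.get 4 (.const 0)) (.inp 1 (.get 4 (.const 0))))) <|
    .seq (.setI 2 (.inp 5 (.const 0)) (.const 1)) <|
      .forLoop 4 0 (.searchStep F)

variable (M : PlanarGraph)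

lemma arr_val {α : Type*} [Zero α] {n : ℕ} (f : Fin n → α) (i : Fin n) : arr f i = f i := by
  simp [arr]

/-- The contents of the working memory after `k` steps of the search. -/
structure SearchState (k : ℕ) (s : Store F) (V : Finset (Fin M.p)) (T : Finset (Fin M.n))
    (φ : Equiv.Perm (Fin M.n)) : Prop where
  tree : M.PartialTree V T φ
  succ_eq : ∀ e : Fin M.n, s.int 1 e = φ e
  visited : ∀ g : Fin M.p, s.int 2 g = if g ∈ V then 1 else 0
  current : s.int 3 0 = (φ ^ k) M.root
  order : ∀ j < k, s.int 0 j = (φ ^ j) M.root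
  processed : ∀ j < k, M.gate (M.next ((φ ^ j) M.root)) ∈ V

variable {M}

/-- The invariant `processed` has two uses: it keeps later transpositions away from the edges
already walked, and at the end it shows that no region edge leaves V. -/
lemma SearchState.step {k : ℕ} {s : Store F} {V : Finset (Fin M.p)} {T : Finset (Fin M.n)}
    {φ : Equiv.Perm (Fin M.n)} (h : SearchState M k s V T φ) (hk : s.int 4 0 = k) :
    ∃ s', Runs (graphInput F M) (.searchStep F) s s' 60 ∧
      (∃ V' T' φ', SearchState M (k + 1) s' V' T' φ') ∧ s'.int 4 0 = k := by
  set e := (φ ^ k) M.root with he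
  have hcur : s.int 3 0 = e := h.current
  obtain ⟨b, hb⟩ : ∃ b, b = M.next e := ⟨_, rfl⟩
  obtain ⟨c, hc⟩ : ∃ c, c = M.rotC⁻¹ e := ⟨_, rfl⟩
  have hback : (graphInput F M).int 4 e = c := by
    rw [hc]
    exact arr_val (fun e => ((M.rotC⁻¹ e : Fin M.n) : ℕ)) e
  have hnext : (graphInput F M).int 2 c = b := by
    rw [hb, PlanarGraph.next, Equiv.Perm.mul_apply, ← hc]
    exact arr_val (fun e => ((M.rotG⁻¹ e : Fin M.n) : ℕ)) c
  have hgate : (graphInput F M).int 5 c = M.gate b := by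
    rw [hb, ← M.gate_rotC_inv, ← hc]
    exact arr_val (fun e => (M.gate e : ℕ)) c
  have heV : M.gate e ∈ V := (h.tree.sameCycle_iff e).2 ⟨k, by rw [zpow_natCast]⟩
  set s₁ := s.setI 0 k e with hs₁
  have hr₁ : Runs (graphInput F M) (.setI 0 (.get 4 (.const 0)) (.get 3 (.const 0))) s s₁ 5 :=
    runs_setI_of_eval 0 hk hcur le_rfl
  by_cases hn : M.gate b ∈ V
  · set s₂ := s₁.setI 3 0 (φ e) with hs₂
    have hr₂ : Runs (graphInput F M) (.setI 3 (.const 0) (.get 1 (.get 3 (.const 0)))) s₁ s₂ 5 :=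
      runs_setI_of_eval 3 rfl (by simp [IExp.eval, hs₁, Store.setI_int, hcur, h.succ_eq]) le_rfl
    refine ⟨s₂, (hr₁.seq ((Runs.iteFalse ?_ runs_skip).seq hr₂)).mono ?_, ⟨V, T, φ, h.tree,
      fun x => ?_, fun g => ?_, ?_, fun j hj => ?_, fun j hj => ?_⟩, ?_⟩
    · simp [Test.Holds, IExp.eval, hs₁, Store.setI_int, hcur, hback, hgate, h.visited, hn]
    · simp [Test.cost, IExp.cost]
    · simpa [hs₂, hs₁, Store.setI_int] using h.succ_eq x
    · simpa [hs₂, hs₁, Store.setI_int] using h.visited g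
    · simp [hs₂, Store.setI_int, he, pow_succ']
    · rcases Nat.lt_succ_iff_lt_or_eq.1 hj with hj | rfl
      · simpa [hs₂, hs₁, Store.setI_int, hj.ne] using h.order j hj
      · simp [hs₂, hs₁, Store.setI_int, he]
    · rcases Nat.lt_succ_iff_lt_or_eq.1 hj with hj | rfl
      · exact h.processed j hj
      · rwa [← he, ← hb]
    · simpa [hs₂, hs₁, Store.setI_int] using hk
  · have hbe : b ≠ e := fun h' => hn (by rwa [h'])
    have hbe' : (b : ℕ) ≠ e := fun h' => hbe (Fin.ext h')
    have htree := h.tree.extend heV (by rwa [← hb])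
    rw [← hb] at htree
    set φ' := φ * Equiv.swap e b with hφ'
    have hφe : φ' e = c := by
      rw [hφ', Equiv.Perm.mul_apply, Equiv.swap_apply_left, h.tree.eq_rotG b hn, hb,
        PlanarGraph.rotG_next, hc]
    have hφb : φ' b = φ e := by
      rw [hφ', Equiv.Perm.mul_apply, Equiv.swap_apply_right]
    have hφx : ∀ x, x ≠ e → x ≠ b → φ' x = φ x := fun x hx hx' => by
      rw [hφ', Equiv.Perm.mul_apply, Equiv.swap_apply_of_ne_of_ne hx hx']
    -- An edge walked earlier is not e, because its region edge leads into V, and not b, because its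
    -- gate is in V.
    have hpow : ∀ j ≤ k, (φ' ^ j) M.root = (φ ^ j) M.root := by
      intro j hj
      induction j with
      | zero => rfl
      | succ j ih =>
        rw [pow_succ', pow_succ', Equiv.Perm.mul_apply, Equiv.Perm.mul_apply, ih (by omega)]
        apply hφx
        · intro h'
          have := h.processed j (by omega)
          rw [h', ← hb] at this
          exact hn this
        · intro h'
          have : M.gate ((φ ^ j) M.root) ∈ V :=
            (h.tree.sameCycle_iff _).2 ⟨j, by rw [zpow_natCast]⟩
          rw [h'] at this
          exact hn this
    set s₂ := s₁.setI 2 (M.gate b) 1 with hs₂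
    -- The old successor of e is handed to b before the entry of e is overwritten.
    set s₃ := s₂.setI 1 b (φ e) with hs₃
    set s₄ := s₃.setI 1 e c with hs₄
    set s₅ := s₄.setI 3 0 c with hs₅
    have hcur₁ : s₁.int 3 0 = e := by simp [hs₁, Store.setI_int, hcur]
    have hcur₂ : s₂.int 3 0 = e := by simp [hs₂, Store.setI_int, hcur₁]
    have hcur₃ : s₃.int 3 0 = e := by simp [hs₃, Store.setI_int, hcur₂]
    have hcur₄ : s₄.int 3 0 = e := by simp [hs₄, Store.setI_int, hcur₃]
    have hr₂ : Runs (graphInput F M)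
        (.setI 2 (.inp 5 (.inp 4 (.get 3 (.const 0)))) (.const 1)) s₁ s₂ 6 :=
      runs_setI_of_eval 2 (by simp only [IExp.eval, hcur₁, hback, hgate]) rfl le_rfl
    have hr₃ : Runs (graphInput F M)
        (.setI 1 (.inp 2 (.inp 4 (.get 3 (.const 0)))) (.get 1 (.get 3 (.const 0)))) s₂ s₃ 8 :=
      runs_setI_of_eval 1 (by simp only [IExp.eval, hcur₂, hback, hnext])
        (by
          simp only [IExp.eval, hcur₂]
          simp [hs₂, hs₁, Store.setI_int, h.succ_eq]) le_rfl
    have hr₄ : Runs (graphInput F M)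
        (.setI 1 (.get 3 (.const 0)) (.inp 4 (.get 3 (.const 0)))) s₃ s₄ 6 :=
      runs_setI_of_eval 1 (by simp only [IExp.eval, hcur₃]) (by simp only [IExp.eval, hcur₃, hback])
        le_rfl
    have hr₅ : Runs (graphInput F M)
        (.setI 3 (.const 0) (.get 1 (.get 3 (.const 0)))) s₄ s₅ 5 :=
      runs_setI_of_eval 3 rfl (by
        simp only [IExp.eval, hcur₄]
        simp [hs₄, Store.setI_int]) le_rfl
    refine ⟨s₅, (hr₁.seq ((Runs.iteTrue ?_ (hr₂.seq (hr₃.seq hr₄))).seq hr₅)).mono ?_,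
      ⟨_, _, φ', htree, fun x => ?_, fun g => ?_, ?_, fun j hj => ?_, fun j hj => ?_⟩, ?_⟩
    · simp only [Test.Holds, IExp.eval, hcur₁, hback, hgate]
      simp [hs₁, Store.setI_int, h.visited, hn]
    · simp [Test.cost, IExp.cost]
    · by_cases hxe : x = e
      · simp [hs₅, hs₄, Store.setI_int, hxe, hφe]
      have hxe' : (x : ℕ) ≠ e := fun h' => hxe (Fin.ext h')
      by_cases hxb : x = b
      · simp [hs₅, hs₄, hs₃, Store.setI_int, hxb, hbe', hφb]
      have hxb' : (x : ℕ) ≠ b := fun h' => hxb (Fin.ext h')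
      simp [hs₅, hs₄, hs₃, hs₂, hs₁, Store.setI_int, hxb', hxe', hφx x hxe hxb, h.succ_eq]
    · by_cases hg : g = M.gate b
      · simp [hs₅, hs₄, hs₃, hs₂, Store.setI_int, hg]
      · have hg' : (g : ℕ) ≠ M.gate b := fun h' => hg (Fin.ext h')
        simp [hs₅, hs₄, hs₃, hs₂, hs₁, Store.setI_int, hg', hg, h.visited]
    · rw [pow_succ', Equiv.Perm.mul_apply, hpow k le_rfl, ← he, hφe]
      simp [hs₅, Store.setI_int]
    · rw [hpow j (by omega)]
      rcases Nat.lt_succ_iff_lt_or_eq.1 hj with hj | rfl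
      · simpa [hs₅, hs₄, hs₃, hs₂, hs₁, Store.setI_int, hj.ne] using h.order j hj
      · simp [hs₅, hs₄, hs₃, hs₂, hs₁, Store.setI_int, he]
    · rw [hpow j (by omega)]
      rcases Nat.lt_succ_iff_lt_or_eq.1 hj with hj | rfl
      · exact mem_insert_of_mem (h.processed j hj)
      · rw [← he, ← hb]
        exact mem_insert_self _ _
    · simpa [hs₅, hs₄, hs₃, hs₂, hs₁, Store.setI_int] using hk

/-- A spanning tree order exists and is found in linear time. -/
theorem orderInTime (F : Type*) [Field F] : OrderInTime F fun M => 200 * (M.n : ℝ) := by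
  refine ⟨.search F, fun M => ?_⟩
  have hn : (graphInput F M).int 0 0 = M.n := rfl
  have hrotG : ∀ x : Fin M.n, (graphInput F M).int 1 x = (M.rotG x : Fin M.n) :=
    fun x => arr_val (fun e => ((M.rotG e : Fin M.n) : ℕ)) x
  let I : ℕ → Store F → Prop := fun k s => (∀ i < k, s.int 1 i = (graphInput F M).int 1 i) ∧
    ∀ i, s.int 2 i = 0 ∧ s.int 3 i = 0
  obtain ⟨s₁, hr₁, hI⟩ := runs_forLoop (inp := graphInput F M) (s := Store.zero F)
    (P := .setI 1 (.get 4 (.const 0)) (.inp 1 (.get 4 (.const 0)))) (c := 4) (B := 6) hn I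
    (fun k s v h => by simpa [I, Store.setI_int] using h)
    (fun k _ s h hc => by
      have hr := runs_setI (inp := graphInput F M) (s := s) 1 (.get 4 (.const 0))
        (.inp 1 (.get 4 (.const 0)))
      simp only [IExp.eval, hc] at hr
      refine ⟨_, hr, ⟨fun i hi => ?_, fun i => ?_⟩, ?_⟩
      · rw [Store.setI_int]
        split_ifs with h'
        · rw [h'.2]
        · exact h.1 i (by omega)
      · simpa [Store.setI_int] using h.2 i
      · simpa [Store.setI_int] using hc)
    ⟨fun i hi => absurd hi (Nat.not_lt_zero i), fun i => ⟨rfl, rfl⟩⟩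
  set s₂ := s₁.setI 2 (M.gate M.root) 1 with hs₂
  have hr₂ : Runs (graphInput F M) (.setI 2 (.inp 5 (.const 0)) (.const 1)) s₁ s₂ 4 := by
    have h0 : (graphInput F M).int 5 0 = M.gate M.root :=
      arr_val (fun e => (M.gate e : ℕ)) M.root
    exact runs_setI_of_eval 2 h0 rfl le_rfl
  have hstart : SearchState M 0 s₂ {M.gate M.root} ∅ M.rotG := by
    refine ⟨M.partialTree_singleton, fun e => ?_, fun g => ?_, ?_, fun j hj => ?_, fun j hj => ?_⟩
    · rw [hs₂, Store.setI_int, if_neg (by simp), hI.1 e e.2, hrotG]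
    · rw [hs₂, Store.setI_int, (hI.2 g).1]
      simp [Fin.ext_iff]
    · rw [hs₂, Store.setI_int, if_neg (by simp), (hI.2 0).2]
      rfl
    · exact absurd hj (Nat.not_lt_zero j)
    · exact absurd hj (Nat.not_lt_zero j)
  obtain ⟨s₃, hr₃, V, T, φ, h⟩ := runs_forLoop (inp := graphInput F M) (s := s₂)
    (P := .searchStep F) (c := 4) (B := 60) hn (fun k s => ∃ V T φ, SearchState M k s V T φ)
    (fun k s v ⟨V, T, φ, h⟩ => ⟨V, T, φ, h.tree,
      fun e => by simpa [Store.setI_int] using h.succ_eq e,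
      fun g => by simpa [Store.setI_int] using h.visited g,
      by simpa [Store.setI_int] using h.current,
      fun j hj => by simpa [Store.setI_int] using h.order j hj, h.processed⟩)
    (fun k _ s ⟨V, T, φ, h⟩ hc => h.step hc) ⟨_, _, _, hstart⟩
  -- The n steps of the walk exhaust the cycle of the root, so every region edge at a gate of V has
  -- been processed.
  have hV : V = univ := by
    refine h.tree.eq_univ fun e he => ?_
    obtain ⟨j, hj, rfl⟩ := h.tree.exists_pow_eq he
    exact h.processed j hj
  subst hV
  obtain ⟨o, ho, hoφ⟩ := h.tree.exists_order
  obtain ⟨t, ht, hex⟩ := hr₁.seq (hr₂.seq hr₃)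
  refine ⟨o, ho, s₃, t, hex, ?_, fun i => ?_⟩
  · have := M.n_pos
    -- The two loops and the first mark cost (17n + 8) + 4 + (71n + 8) steps.
    have : t ≤ 200 * M.n := by omega
    beta_reduce
    exact_mod_cast this
  · rw [h.order i i.2, hoφ]

end Search

end PfCircuit

theorem mainTheorem2 (F : Type*) [Field F] :
    -- a spanning tree order exists and is found in linear time
    (∃ c : ℝ, OrderInTime F fun M => c * M.n) ∧
    -- the value of a closed Pfaffian circuit is `γ * Pf Ω`
    (∀ (M : PlanarGraph) (o : Equiv.Perm (Fin M.n)), M.IsSpanningTreeOrder o →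
      ∀ (C : Circuit F M) (D : PfaffianData F M o), D.Represents C →
        C.value = D.γ * pf D.Ω) ∧
    -- it costs as much as one planar Pfaffian with the same graph, up to linear overhead
    (∃ c : ℝ, ∀ (K : Set PlanarGraph) (T : PlanarGraph → ℝ),
      PlanarPfaffianInTime F K T → CircuitValueInTime F K fun M => c * (T M + M.n)) ∧
    -- in particular it is `O(n ^ ω)` whenever planar Pfaffian evaluation is
    (∀ (K : Set PlanarGraph) (ω : ℝ), 1 ≤ ω →
      (∃ c : ℝ, PlanarPfaffianInTime F K fun M => c * (M.n : ℝ) ^ ω) →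
        ∃ c : ℝ, CircuitValueInTime F K fun M => c * (M.n : ℝ) ^ ω) := by
  exact ⟨⟨200, orderInTime F⟩, fun _ _ ho _ _ h => h.value_eq_pf ho,
    ⟨100, fun _ _ h => .of_planarPfaffian h⟩,
    fun _ _ hω ⟨c, h⟩ => ⟨100 * (c + 1), .of_planarPfaffian_rpow hω h⟩⟩
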